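/- **Model.** We work in the deterministic $\mathsf{CONGEST}$ model. The communication network is an $n$-node undirected graph $G$ with integer edge weights in $\{0,\dots,n^k\}$ and unique node identifiers below $n^k$, for a fixed exponent $k$. In each synchronous round every node sends one message of at most $b$ times the number of bits of $n$ (that is, $O(\log n)$ bits) to each neighbor. Local computation is free. Initially a node knows $n$, its own identifier, and the identifiers of its neighbors together with the weights of its incident edges. At the end, both endpoints of every edge know whether the edge belongs to the output. A subgraph $H=(V,E')$ of $G=(V,E)$ is an *$\alpha$-spanner* if $d_H(u,v)\le \alpha\, d_G(u,v)$ for all $u,v\in V$, where $d$ is the weighted distance ($\infty$ between different components). An *$r$-clustering* of $G$ is a family of disjoint clusters (sets of nodes), each of them spanned by a rooted tree in the subgraph that it induces, all of whose nodes have hop-distance at most $r$ from the root. The *$r$-cluster-graph* $H$ has the clusters as nodes and is obtained by contracting every cluster; its edges are the edges of $G$ between different clusters. An algorithm on an $r$-cluster-graph communicates over $G$. In addition to the above, each node initially knows $r$, an upper bound $N\le n$ on the number of clusters and, if it lies in a cluster, the identifiers of the root of its cluster and of its parent in the tree. **Theorem.** For every $k$ there is a constant $C>0$, and for every $b$ there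 is a $b'$ (depending only on $k$ and $b$), such that the following holds. Let $\alpha,s:\mathbb N\to\mathbb R$ be nondecreasing with $\alpha\ge 1$, and let $T:\mathbb N\times\mathbb N\to\mathbb N$ be nondecreasing in its first argument. Suppose that there is a deterministic distributed algorithm $A$, with message constant $b$, that computes an $\alpha(N)$-spanner with at most $N\cdot s(N)$ edges of every weighted $r$-cluster-graph with at most $N$ nodes in $T(N,r)$ rounds, for all $N$ and $r$. Then for every real $t\ge 1$ there is a deterministic distributed algorithm $A'$, with message constant $b'$, that computes a $\bigl(C\, t\, s(n)\,\alpha(n)\bigr)$-spanner with at most $n+n/t$ edges of every $n$-node weighted graph, for every $n$, in at most $$C\left(t\, s(n)\,\log^* n+T\!\left(\left\lfloor\frac{n}{t\, s(n)}\right\rfloor,\ \bigl\lfloor C\, t\, s(n)\bigr\rfloor\right)\right)$$ rounds. -/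

import Mathlib

open scoped ENNReal

/-- The iterated logarithm `log* n`: the number of times `log₂` has to be applied to `n` before the
value is at most `1`. Since `x ≤ 2 ^ m ↔ ⌈log₂ x⌉ ≤ m`, rounding up in every step does not change
this number. -/
noncomputable def logStar (n : ℕ) : ℕ := sInf {j : ℕ | (Nat.clog 2)^[j] n ≤ 1}

/-- A graph with non-negative integer edge weights (only the weights of edges matter). -/
structure WeightedGraph (V : Type) where
  graph : SimpleGraph V
  weight : Sym2 V → ℕ

namespace WeightedGraph

variable {V : Type}

/-- The total weight of a walk. -/
def length (G : WeightedGraph V) {u v : V} (p : G.graph.Walk u v) : ℕ :=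
  (p.edges.map G.weight).sum

/-- The weighted distance, which is `∞` between different connected components. -/
noncomputable def dist (G : WeightedGraph V) (u v : V) : ℝ≥0∞ :=
  ⨅ p : G.graph.Walk u v, (G.length p : ℝ≥0∞)

/-- The graph `F` with the edge weights of `G`. -/
def restrict (G : WeightedGraph V) (F : SimpleGraph V) : WeightedGraph V := ⟨F, G.weight⟩

/-- All distances in `H` are at most `α` times the corresponding distances in `G`. -/
def HasStretch (H G : WeightedGraph V) (α : ℝ) : Prop :=
  ∀ u v : V, H.dist u v ≤ ENNReal.ofReal α * G.dist u v

/-- `F` is (the edge set of) an `α`-spanner of `G`. -/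
def IsSpanner (G : WeightedGraph V) (F : SimpleGraph V) (α : ℝ) : Prop :=
  F ≤ G.graph ∧ (G.restrict F).HasStretch G α

end WeightedGraph

/-- An `r`-clustering of `G`: disjoint clusters, each of them spanned by a rooted tree of `G` inside
the cluster, in which every node has hop-distance at most `r` from the root. `nodes` is the union of
the clusters, `parent` is the parent in the tree, and the roots are the nodes that are their own
parents. Two nodes lie in the same cluster if their trees have the same root. -/
structure Clustering {V : Type} (G : SimpleGraph V) (r : ℕ) where
  nodes : Set V
  parent : V → V
  parent_mem : ∀ v ∈ nodes, parent v ∈ nodes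
  parent_adj : ∀ v ∈ nodes, parent v ≠ v → G.Adj v (parent v)
  radius_le : ∀ v ∈ nodes, parent (parent^[r] v) = parent^[r] v

namespace Clustering

variable {V : Type} {G : SimpleGraph V} {r : ℕ}

/-- The root of the tree of the cluster of `v` (for `v ∈ nodes`). -/
def root (K : Clustering G r) (v : V) : V := K.parent^[r] v

/-- The nodes of the cluster graph: the clusters, each represented by its root. -/
abbrev Node (K : Clustering G r) : Type := {c : V // c ∈ K.nodes ∧ K.parent c = c}

/-- The weighted graph on the clusters obtained from a weighted graph `W` on `V` by contracting
every cluster to one node. Among parallel edges the lightest one determines the weight. -/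
noncomputable def contract (K : Clustering G r) (W : WeightedGraph V) : WeightedGraph K.Node where
  graph :=
    { Adj := fun c d => c ≠ d ∧ ∃ u ∈ K.nodes, ∃ v ∈ K.nodes,
        W.graph.Adj u v ∧ K.root u = c.1 ∧ K.root v = d.1
      symm := ⟨by
        rintro c d ⟨hne, u, hu, v, hv, h, h1, h2⟩
        exact ⟨hne.symm, v, hv, u, hu, h.symm, h2, h1⟩⟩
      loopless := ⟨fun _ h => h.1 rfl⟩ }
  weight := fun e => sInf {x : ℕ | ∃ u ∈ K.nodes, ∃ v ∈ K.nodes,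
    W.graph.Adj u v ∧ e.map Subtype.val = s(K.root u, K.root v) ∧ x = W.weight s(u, v)}

/-- `F` is (the edge set of) an `α`-spanner of the cluster graph of `W`: it consists of edges of `W`
between different clusters, and contracting the clusters in `F` and in `W` gives graphs whose
distances differ by a factor of at most `α`. -/
def IsSpanner (K : Clustering G r) (W : WeightedGraph V) (F : SimpleGraph V) (α : ℝ) : Prop :=
  F ≤ W.graph ∧
  (∀ u v, F.Adj u v → u ∈ K.nodes ∧ v ∈ K.nodes ∧ K.root u ≠ K.root v) ∧
  (K.contract (W.restrict F)).HasStretch (K.contract W) α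

end Clustering

/-- A CONGEST network with `n` processors whose identifiers and edge weights are bounded by the
polynomial `n ^ k`. The names `Fin n` of the processors are not known to the processors. -/
structure Network (n k : ℕ) extends WeightedGraph (Fin n) where
  ident : Fin n → ℕ
  ident_injective : Function.Injective ident
  ident_lt : ∀ v, ident v < n ^ k
  weight_le : ∀ e ∈ graph.edgeSet, weight e ≤ n ^ k

/-- What a processor knows at the start: the number of processors, its own identifier, and its
incident edges; `nbr i = some x` if it has an edge of weight `x` to the processor with identifier
`i`, and `nbr i = none` if it has no neighbor with this identifier. -/
structure LocalView where
  size : ℕ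
  ident : ℕ
  nbr : ℕ → Option ℕ

/-- What a processor knows at the start of an algorithm on a cluster graph: besides its view of the
network, an upper bound on the number of clusters, the bound on the radius and, if it is in a
cluster, the identifiers of the root of the cluster and of its own parent in the tree. -/
structure ClusterView extends LocalView where
  numClusters : ℕ
  radius : ℕ
  cluster : Option (ℕ × ℕ)

/-- A deterministic synchronous message-passing algorithm for processors with initial knowledge in
`I`. In each round, a processor in state `x` sends the message `send x i` to its neighbor with
identifier `i`; then it computes its new state from the old one and the messages that it received,
indexed by the identifiers of its neighbors. Messages are numbers; their bits are counted. The
output is a set of identifiers of neighbors, that is, a set of incident edges. -/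
structure Algorithm (I : Type) where
  State : Type
  init : I → State
  send : State → ℕ → ℕ
  receive : State → (ℕ → Option ℕ) → State
  output : State → Set ℕ

namespace Network

variable {n k : ℕ} {I : Type}

open Classical in
/-- A family of values of the neighbors of `v`, indexed by the identifiers of the neighbors. -/
noncomputable def fromNbrs (net : Network n k) (v : Fin n) (f : Fin n → ℕ) (i : ℕ) : Option ℕ :=
  if h : ∃ u, net.graph.Adj v u ∧ net.ident u = i then some (f h.choose) else none

/-- The initial knowledge of the processor `v`. -/
noncomputable def view (net : Network n k) (v : Fin n) : LocalView :=
  ⟨n, net.ident v, net.fromNbrs v fun u => net.weight s(v, u)⟩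

open Classical in
/-- The initial knowledge of `v` when a cluster graph with at most `N` nodes is the input. -/
noncomputable def clusterView (net : Network n k) {r : ℕ} (K : Clustering net.graph r) (N : ℕ)
    (v : Fin n) : ClusterView :=
  { net.view v with
    numClusters := N
    radius := r
    cluster := if v ∈ K.nodes then some (net.ident (K.root v), net.ident (K.parent v)) else none }

/-- The states of the processors after `j` rounds. -/
noncomputable def config (net : Network n k) (A : Algorithm I) (input : Fin n → I) :
    ℕ → Fin n → A.State
  | 0 => fun v => A.init (input v)
  | j + 1 => fun v => A.receive (net.config A input j v)
      (net.fromNbrs v fun u => A.send (net.config A input j u) (net.ident v))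

/-- Within `τ` rounds, using messages of at most `b` times the number of bits of `n`, the algorithm
computes the subgraph `F`: both endpoints of each edge of the network know whether it is in `F`. -/
def Computes (net : Network n k) (A : Algorithm I) (input : Fin n → I) (b τ : ℕ)
    (F : SimpleGraph (Fin n)) : Prop :=
  (∀ j < τ, ∀ u v, net.graph.Adj u v →
    Nat.size (A.send (net.config A input j u) (net.ident v)) ≤ b * Nat.size n) ∧
  ∀ u v, net.graph.Adj u v → (net.ident v ∈ A.output (net.config A input τ u) ↔ F.Adj u v)

end Network

/-- With messages of at most `b` times the number of bits of `n`, in all networks whose identifiers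
and weights are at most `n ^ k`, the algorithm computes an `α N`-spanner with at most `N * s N`
edges of each `r`-cluster-graph with at most `N` nodes in `T N r` rounds. -/
def Algorithm.SolvesClusterGraphs (A : Algorithm ClusterView) (k b : ℕ) (α s : ℕ → ℝ)
    (T : ℕ → ℕ → ℕ) : Prop :=
  ∀ (n N r : ℕ), N ≤ n → ∀ (net : Network n k) (K : Clustering net.graph r),
    Nat.card K.Node ≤ N →
    ∃ F : SimpleGraph (Fin n), net.Computes A (net.clusterView K N) b (T N r) F ∧
      K.IsSpanner net.toWeightedGraph F (α N) ∧ (F.edgeSet.ncard : ℝ) ≤ N * s N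

open SimpleGraph

/-! The spanner is the union of a forest `F` of light edges and of the spanner that `A` finds on the
cluster graph whose clusters are trees of `F`. If every cluster that is not a whole component has at
least `2 ^ i ≥ t * s n` nodes, then there are at most `n / (t * s n)` such clusters. So `A`
contributes at most `n / t` edges, and the forest at most `n`.

The clusters arise in Borůvka phases. Breaking ties between weights by identifiers makes the keys of
the edges distinct. Every merging edge is the lightest one that leaves some cluster, so `F` is
acyclic (`isAcyclic_of_forall_lightest_in_cut`). The invariant `IsFragments` says that the tree walk
from `v` to its root has at most `R` edges, none of them heavier than any edge from `v` to another
cluster. Hence an edge of weight `w` between two clusters has a detour through the two roots: it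
costs at most `R * w` at each end, and in between it follows a walk of the cluster spanner, each
edge of which costs `2 * R + 1` times its weight. This gives stretch `(4 * R + 1) * α`
(`isSpanner_sup`).

The radius has to stay proportional to the size `2 ^ i`. In each phase only clusters of radius at
most `D`, twice the current size bound, point along their lightest outgoing edge; all others already
have enough nodes (`IsFragments.lt_ncard_of_not_isActive`). Pointers can form long chains.
Cole-Vishkin steps color the clusters with a constant number `q` of colors in `log* n` iterations,
and local maxima drop their pointers. Chains without local maxima have `O(q)` links
(`exists_not_keeps`), while a local maximum is still joined to a predecessor, so sizes double
(`IsFragments.merge`). A chain crosses small clusters only, except for the last one. A phase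
therefore adds `O(q * D)` to the radius instead of multiplying it, and the radii form a geometric
sum (`exists_fragments`).

On the distributed side, `Known` is a calculus of what can be learned in a given number of rounds. A
phase consists of `log* n + O(1)` floodings of clusters of diameter `O(2 ^ i)`, and the last phase
dominates the running time. -/

/-! ### Attained minima and forests. -/

theorem exists_eq_of_iInf_eq_coe {ι : Type*} {p : ι → Prop} {f : ι → ℕ∞} {a : ℕ}
    (h : ⨅ i, ⨅ (_ : p i), f i = a) : ∃ i, p i ∧ f i = a := by
  rcases isEmpty_or_nonempty ι with hι | hι
  · rw [iInf_of_empty] at h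
    exact absurd h (ENat.top_ne_natCast a)
  obtain ⟨i, hi⟩ := ciInf_mem fun i => ⨅ (_ : p i), f i
  have hi' : ⨅ (_ : p i), f i = a := hi.trans h
  by_cases hp : p i
  · exact ⟨i, hp, by simpa [hp] using hi'⟩
  · simp [hp] at hi'

theorem exists_eq_of_iInf_ne_top {ι : Type*} {p : ι → Prop} {f : ι → ℕ∞}
    (h : ⨅ i, ⨅ (_ : p i), f i ≠ ⊤) : ∃ i, p i ∧ f i = ⨅ i, ⨅ (_ : p i), f i := by
  obtain ⟨a, ha⟩ := ENat.ne_top_iff_exists.1 h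
  rw [← ha]
  exact exists_eq_of_iInf_eq_coe ha.symm

namespace SimpleGraph

variable {V : Type} {F G : SimpleGraph V}

/-- A graph is acyclic if each of its edges is the unique lightest edge of some cut. -/
theorem isAcyclic_of_forall_lightest_in_cut [Finite V] (key : Sym2 V → ℕ)
    (hkey : Set.InjOn key F.edgeSet)
    (hcut : ∀ e ∈ F.edgeSet, ∃ S : Set V, (∃ a b, e = s(a, b) ∧ a ∈ S ∧ b ∉ S) ∧
      ∀ u v, F.Adj u v → u ∈ S → v ∉ S → key e ≤ key s(u, v)) : F.IsAcyclic := by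
  let H : ℕ → SimpleGraph V := fun m => fromEdgeSet {e | e ∈ F.edgeSet ∧ key e < m}
  have hH : ∀ m u v, (H m).Adj u v ↔ F.Adj u v ∧ key s(u, v) < m := by
    intro m u v
    simp only [H, fromEdgeSet_adj, Set.mem_ofPred_eq, mem_edgeSet]
    exact ⟨fun h => h.1, fun h => ⟨h, h.1.ne⟩⟩
  have main : ∀ m, (H m).IsAcyclic := by
    intro m
    induction m with
    | zero =>
      have : H 0 = ⊥ := by ext u v; simp [hH]
      rw [this]; exact isAcyclic_bot
    | succ m ih =>
      by_cases hm : ∃ e ∈ F.edgeSet, key e = m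
      · obtain ⟨e, he, hem⟩ := hm
        obtain ⟨S, ⟨a, b, rfl, ha, hb⟩, hS⟩ := hcut e he
        -- All edges of `H m` have keys below `m`, the least key of an edge of `F` across the cut
        -- `S`; so no walk in `H m` leaves `S`.
        have hr : ¬ (H m).Reachable a b := by
          rintro ⟨p⟩
          obtain ⟨d, -, h1, h2⟩ := p.exists_boundary_dart S ha hb
          have h3 := (hH _ _ _).1 d.adj
          have := hS _ _ h3.1 h1 h2
          omega
        refine (ih.sup_edge_of_not_reachable hr).anti ?_
        intro u v huv
        obtain ⟨h1, h2⟩ := (hH _ _ _).1 huv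
        by_cases h3 : key s(u, v) = m
        · have : s(u, v) = s(a, b) := hkey h1 he (h3.trans hem.symm)
          refine Or.inr ?_
          rw [← mem_edgeSet, this, mem_edgeSet, edge_adj]
          have : a ≠ b := fun h => hb (h ▸ ha)
          simp [this]
        · exact Or.inl ((hH _ _ _).2 ⟨h1, by omega⟩)
      · refine ih.anti ?_
        intro u v huv
        obtain ⟨h1, h2⟩ := (hH _ _ _).1 huv
        have : key s(u, v) ≠ m := fun h => hm ⟨_, h1, h⟩
        exact (hH _ _ _).2 ⟨h1, by omega⟩
  obtain ⟨m, hm⟩ := (Set.finite_range key).bddAbove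
  refine (main (m + 1)).anti ?_
  intro u v huv
  exact (hH _ _ _).2 ⟨huv, Nat.lt_succ_of_le (hm ⟨_, rfl⟩)⟩

/-- In a forest, a walk with edges in a set can be chosen as short as any other walk. -/
theorem IsAcyclic.exists_walk_length_le (hF : F.IsAcyclic) {u v : V} (p q : F.Walk u v) :
    ∃ w : F.Walk u v, w.length ≤ p.length ∧ ∀ e ∈ w.edges, e ∈ q.edges := by
  classical
  refine ⟨p.bypass, p.length_bypass_le_length, ?_⟩
  have : p.bypass = q.bypass := congrArg Subtype.val
    ((hF.subsingleton_path u v).elim ⟨p.bypass, p.bypass_isPath⟩ ⟨q.bypass, q.bypass_isPath⟩)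
  rw [this]
  exact fun e he => q.edges_bypass_subset_edges he

theorem IsAcyclic.ncard_edgeSet_le [Finite V] (hF : F.IsAcyclic) :
    F.edgeSet.ncard ≤ Nat.card V := by
  classical
  have := Fintype.ofFinite V
  rcases isEmpty_or_nonempty V with hV | hV
  · have : F.edgeSet = ∅ := by
      ext e; induction e with | _ u v => exact hV.elim u
    simp [this]
  obtain ⟨T, hT, -, htree⟩ :=
    (connected_top (V := V)).exists_isTree_le_of_le_of_isAcyclic (le_top : F ≤ ⊤) hF
  have h1 := htree.card_edgeFinset
  have h2 : F.edgeSet.ncard ≤ T.edgeSet.ncard :=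
    Set.ncard_le_ncard (edgeSet_mono hT) (Set.toFinite _)
  rw [Set.ncard_eq_toFinset_card' T.edgeSet] at h2
  rw [Nat.card_eq_fintype_card]
  change T.edgeSet.toFinset.card + 1 = _ at h1
  omega

theorem exists_walk_length_lt [Finite V] {u v : V} (p : F.Walk u v) :
    ∃ q : F.Walk u v, q.length < Nat.card V ∧ q.length ≤ p.length := by
  classical
  have := Fintype.ofFinite V
  exact ⟨p.bypass, by simpa using p.bypass_isPath.length_lt, p.length_bypass_le_length⟩

theorem Walk.apply_eq_of_adj {X : Type*} {f : V → X} (h : ∀ u v, F.Adj u v → f u = f v) {u v : V}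
    (p : F.Walk u v) : f u = f v := by
  induction p with
  | nil => rfl
  | cons e p ih => exact (h _ _ e).trans ih

end SimpleGraph

/-! ### Clusters spanned by trees of light edges. -/

variable {V : Type}

/-- The smallest key of an edge between `v` and another cluster. -/
noncomputable def outKey (G : SimpleGraph V) (key : Sym2 V → ℕ) (lead : V → V) (v : V) : ℕ∞ :=
  ⨅ u, ⨅ (_ : G.Adj v u ∧ lead u ≠ lead v), (key s(v, u) : ℕ∞)

/-- The smallest value in the cluster of `v`. -/
noncomputable def clusterInf {L : Type*} (lead : V → L) (x : V → ℕ∞) (v : V) : ℕ∞ :=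
  ⨅ u, ⨅ (_ : lead u = lead v), x u

theorem clusterInf_le {L : Type*} (lead : V → L) (x : V → ℕ∞) {u v : V} (h : lead u = lead v) :
    clusterInf lead x v ≤ x u := iInf₂_le u h

theorem clusterInf_congr {L : Type*} (lead : V → L) (x : V → ℕ∞) {u v : V} (h : lead u = lead v) :
    clusterInf lead x u = clusterInf lead x v := by
  simp only [clusterInf, h]

theorem exists_of_clusterInf_ne_top {L : Type*} {lead : V → L} {x : V → ℕ∞} {v : V}
    (h : clusterInf lead x v ≠ ⊤) : ∃ u, lead u = lead v ∧ x u = clusterInf lead x v :=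
  exists_eq_of_iInf_ne_top h

theorem outKey_le {G : SimpleGraph V} {key : Sym2 V → ℕ} {lead : V → V} {u v : V}
    (h : G.Adj v u) (hne : lead u ≠ lead v) : outKey G key lead v ≤ key s(v, u) :=
  iInf₂_le u ⟨h, hne⟩

theorem exists_of_outKey_ne_top {G : SimpleGraph V} {key : Sym2 V → ℕ} {lead : V → V} {v : V}
    (h : outKey G key lead v ≠ ⊤) :
    ∃ u, G.Adj v u ∧ lead u ≠ lead v ∧ (key s(v, u) : ℕ∞) = outKey G key lead v := by
  obtain ⟨u, ⟨h1, h2⟩, h3⟩ := exists_eq_of_iInf_ne_top h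
  exact ⟨u, h1, h2, h3⟩

/-- A clustering of `G` into the trees of the forest `F`, with the roots `lead`. All trees have
radius at most `R`, all clusters that are not connected components of `G` have at least `S` nodes,
and the edges of the forest are lightest edges in cuts. -/
structure IsFragments (G : SimpleGraph V) (key : Sym2 V → ℕ) (F : SimpleGraph V) (lead : V → V)
    (R S : ℕ) : Prop where
  le : F ≤ G
  lead_eq : ∀ u v, F.Adj u v → lead u = lead v
  walk : ∀ v, ∃ p : F.Walk v (lead v), p.length ≤ R ∧
    ∀ e ∈ p.edges, (key e : ℕ∞) ≤ outKey G key lead v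
  inner : ∀ u v, G.Adj u v → lead u = lead v →
    ∃ p : F.Walk u v, p.length ≤ 2 * R ∧ ∀ e ∈ p.edges, key e ≤ key s(u, v)
  cut : ∀ e ∈ F.edgeSet, ∃ S : Set V, (∃ a b, e = s(a, b) ∧ a ∈ S ∧ b ∉ S) ∧
    ∀ u v, G.Adj u v → u ∈ S → v ∉ S → key e ≤ key s(u, v)
  size : ∀ v, clusterInf lead (outKey G key lead) v ≠ ⊤ → S ≤ {u | lead u = lead v}.ncard

namespace IsFragments

variable {G F : SimpleGraph V} {key : Sym2 V → ℕ} {lead : V → V} {R S : ℕ}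

theorem isAcyclic [Finite V] (h : IsFragments G key F lead R S)
    (hkey : Set.InjOn key G.edgeSet) : F.IsAcyclic := by
  refine isAcyclic_of_forall_lightest_in_cut key (hkey.mono (edgeSet_mono h.le)) fun e he => ?_
  obtain ⟨S, h1, h2⟩ := h.cut e he
  exact ⟨S, h1, fun u v huv => h2 u v (h.le huv)⟩

theorem lead_lead (h : IsFragments G key F lead R S) (v : V) : lead (lead v) = lead v := by
  obtain ⟨p, -⟩ := h.walk v
  exact (p.apply_eq_of_adj h.lead_eq).symm

theorem exists_walk (h : IsFragments G key F lead R S) {u v : V} (huv : lead u = lead v) :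
    ∃ p : F.Walk u v, p.length ≤ 2 * R := by
  obtain ⟨p, hp, -⟩ := h.walk u
  obtain ⟨q, hq, -⟩ := h.walk v
  refine ⟨p.append (q.reverse.copy huv.symm rfl), ?_⟩
  simp; omega

theorem singletons (G : SimpleGraph V) (key : Sym2 V → ℕ) :
    IsFragments G key ⊥ id 0 1 where
  le := bot_le
  lead_eq := by simp
  walk v := ⟨Walk.nil, by simp⟩
  inner u v h hne := absurd hne h.ne
  cut := by simp
  size := by simp

end IsFragments

/-! ### Cutting chains of pointers at local maxima of a coloring -/

/-- A sequence of colors below `q` without local maxima has bounded length. -/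
theorem false_of_no_local_max {a : ℕ → ℕ} {q : ℕ} (hq : ∀ j ≤ 2 * q + 1, a j < q)
    (hne : ∀ j ≤ 2 * q, a j ≠ a (j + 1))
    (hmax : ∀ j < 2 * q, a j < a (j + 1) → a (j + 1) ≤ a (j + 2)) : False := by
  -- Without local maxima an ascent is followed by ascents only, and `q` ascents in a row exhaust
  -- the colors. If there is no early ascent, then `q` descents in a row do.
  by_cases h : ∃ j ≤ q, a j < a (j + 1)
  · obtain ⟨j, hj, hlt⟩ := h
    have inc : ∀ i, j + i ≤ 2 * q → a (j + i) < a (j + i + 1) := by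
      intro i
      induction i with
      | zero => exact fun _ => hlt
      | succ i ih =>
        intro hi
        have h1 := hmax (j + i) (by omega) (ih (by omega))
        have h2 := hne (j + i + 1) (by omega)
        exact lt_of_le_of_ne h1 h2
    have low : ∀ i, j + i ≤ 2 * q → i ≤ a (j + i) := by
      intro i
      induction i with
      | zero => exact fun _ => Nat.zero_le _
      | succ i ih =>
        intro hi
        have h1 := ih (by omega)
        have h2 := inc i (by omega)
        have : j + (i + 1) = j + i + 1 := by omega
        rw [this]; omega
    have h1 := low q (by omega)
    have h2 := hq (j + q) (by omega)
    omega
  · push Not at h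
    have dec : ∀ j ≤ q, a j + j ≤ a 0 := by
      intro j
      induction j with
      | zero => simp
      | succ j ih =>
        intro hj
        have h1 := ih (by omega)
        have h2 := h j (by omega)
        have h3 := hne j (by omega)
        omega
    have h1 := dec q le_rfl
    have h2 := hq 0 (by omega)
    omega

variable {V : Type}

/-- The value of `c` at the cluster to which the cluster of `v` points, or `⊤`. -/
noncomputable def nextInf {L : Type*} (lead : V → L) (P : V → V → Prop) (c : V → ℕ) (v : V) : ℕ∞ :=
  clusterInf lead (fun x => ⨅ y, ⨅ (_ : P x y), (c y : ℕ∞)) v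

/-- The smallest value of `c` at a cluster that points to the cluster of `v`. -/
noncomputable def prevInf {L : Type*} (lead : V → L) (P : V → V → Prop) (c : V → ℕ) (v : V) : ℕ∞ :=
  clusterInf lead (fun y => ⨅ x, ⨅ (_ : P x y), (c x : ℕ∞)) v

/-- Every cluster points to at most one other cluster, by means of one edge. -/
structure IsPointing {L : Type*} (lead : V → L) (P : V → V → Prop) : Prop where
  unique : ∀ x y x' y', P x y → P x' y' → lead x = lead x' → x = x' ∧ y = y'
  ne : ∀ x y, P x y → lead x ≠ lead y

section Pointing

variable {L : Type*} {lead : V → L} {P : V → V → Prop} {c : V → ℕ}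

theorem exists_of_nextInf_ne_top {v : V} (h : nextInf lead P c v ≠ ⊤) :
    ∃ x y, lead x = lead v ∧ P x y ∧ (c y : ℕ∞) = nextInf lead P c v := by
  obtain ⟨x, hx, h1⟩ := exists_of_clusterInf_ne_top h
  obtain ⟨y, hy, h2⟩ := exists_eq_of_iInf_ne_top (h1.trans_ne h)
  exact ⟨x, y, hx, hy, h2.trans h1⟩

theorem exists_of_prevInf_ne_top {v : V} (h : prevInf lead P c v ≠ ⊤) :
    ∃ x y, lead y = lead v ∧ P x y ∧ (c x : ℕ∞) = prevInf lead P c v := by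
  obtain ⟨y, hy, h1⟩ := exists_of_clusterInf_ne_top h
  obtain ⟨x, hx, h2⟩ := exists_eq_of_iInf_ne_top (h1.trans_ne h)
  exact ⟨x, y, hy, hx, h2.trans h1⟩

theorem nextInf_le {x y v : V} (hx : lead x = lead v) (h : P x y) :
    nextInf lead P c v ≤ c y :=
  (clusterInf_le lead _ hx).trans (iInf₂_le y h)

theorem prevInf_le {x y v : V} (hy : lead y = lead v) (h : P x y) :
    prevInf lead P c v ≤ c x :=
  (clusterInf_le lead _ hy).trans (iInf₂_le x h)

theorem IsPointing.nextInf_eq (hP : IsPointing lead P) {x y v : V} (hx : lead x = lead v)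
    (h : P x y) : nextInf lead P c v = c y := by
  obtain ⟨x', y', hx', h', he⟩ := exists_of_nextInf_ne_top (P := P) (c := c)
    (ne_top_of_le_ne_top (ENat.natCast_ne_top _) (nextInf_le hx h))
  obtain ⟨-, rfl⟩ := hP.unique x y x' y' h h' (hx.trans hx'.symm)
  exact he.symm

/-- The clusters that are local maxima of the coloring `c`. -/
def IsPeak (lead : V → L) (P : V → V → Prop) (c : V → ℕ) (v : V) : Prop :=
  nextInf lead P c v < c v ∧ prevInf lead P c v < c v

/-- The pointers of the clusters that are not local maxima. -/
def KeepEdge (lead : V → L) (P : V → V → Prop) (c : V → ℕ) (x y : V) : Prop :=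
  P x y ∧ ¬ IsPeak lead P c x

def Keeps (lead : V → L) (P : V → V → Prop) (c : V → ℕ) (v : V) : Prop :=
  ∃ x y, lead x = lead v ∧ KeepEdge lead P c x y

theorem IsPeak.congr (hc : ∀ u v, lead u = lead v → c u = c v) {u v : V} (h : lead u = lead v) :
    IsPeak lead P c u ↔ IsPeak lead P c v := by
  simp only [IsPeak, nextInf, prevInf, clusterInf_congr lead _ h, hc u v h]

theorem Keeps.congr {u v : V} (h : lead u = lead v) : Keeps lead P c u ↔ Keeps lead P c v := by
  simp only [Keeps, h]

/-- The forest `F` with the kept pointers. -/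
def mergeGraph (F : SimpleGraph V) (lead : V → L) (P : V → V → Prop) (c : V → ℕ) : SimpleGraph V :=
  F ⊔ fromRel (KeepEdge lead P c)

theorem mergeGraph_adj_of_keepEdge (hP : IsPointing lead P) (F : SimpleGraph V) {x y : V}
    (h : KeepEdge lead P c x y) : (mergeGraph F lead P c).Adj x y :=
  Or.inr ⟨fun e => hP.ne x y h.1 (congrArg lead e), Or.inl h⟩

end Pointing

section Hop

variable {lead : V → V} {P : V → V → Prop} {c : V → ℕ}

open Classical in
/-- The root of the cluster to which the cluster of `v` has a kept pointer, or else the root of the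
cluster of `v`. -/
noncomputable def hop (lead : V → V) (P : V → V → Prop) (c : V → ℕ) (v : V) : V :=
  if h : Keeps lead P c v then lead h.choose_spec.choose else lead v

theorem hop_of_keepEdge (hP : IsPointing lead P) {x y v : V} (hx : lead x = lead v)
    (h : KeepEdge lead P c x y) : hop lead P c v = lead y := by
  have hk : Keeps lead P c v := ⟨x, y, hx, h⟩
  rw [hop, dif_pos hk]
  obtain ⟨h1, h2⟩ := hk.choose_spec.choose_spec
  rw [(hP.unique _ _ _ _ h2.1 h.1 (h1.trans hx.symm)).2]

theorem hop_of_not_keeps {v : V} (h : ¬ Keeps lead P c v) : hop lead P c v = lead v := by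
  rw [hop, dif_neg h]

theorem hop_congr (hP : IsPointing lead P) {u v : V} (h : lead u = lead v) :
    hop lead P c u = hop lead P c v := by
  by_cases hk : Keeps lead P c u
  · obtain ⟨x, y, hx, hxy⟩ := hk
    rw [hop_of_keepEdge hP hx hxy, hop_of_keepEdge hP (hx.trans h) hxy]
  · rw [hop_of_not_keeps hk, hop_of_not_keeps ((Keeps.congr h).not.1 hk), h]

theorem lead_iterate_hop_congr (hP : IsPointing lead P) {u v : V} (h : lead u = lead v) (m : ℕ) :
    lead ((hop lead P c)^[m] u) = lead ((hop lead P c)^[m] v) := by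
  cases m with
  | zero => exact h
  | succ m => rw [Function.iterate_succ_apply, Function.iterate_succ_apply, hop_congr hP h]

variable (hP : IsPointing lead P) (hlead : ∀ v, lead (lead v) = lead v)

include hP hlead

theorem iterate_hop_of_not_keeps {v : V} {m : ℕ} (h : ¬ Keeps lead P c ((hop lead P c)^[m] v))
    (j : ℕ) : (hop lead P c)^[m + 1 + j] v = lead ((hop lead P c)^[m] v) := by
  induction j with
  | zero => rw [add_zero, Function.iterate_succ_apply', hop_of_not_keeps h]
  | succ j ih =>
    rw [← add_assoc, Function.iterate_succ_apply', ih, hop_congr hP (hlead _), hop_of_not_keeps h]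

/-- Chains of kept pointers are short. -/
theorem exists_not_keeps {q : ℕ} (hc : ∀ u v, lead u = lead v → c u = c v)
    (hq : ∀ v, c v < q) (hproper : ∀ x y, P x y → c x ≠ c y) (v : V) :
    ∃ m ≤ 2 * q + 1, ¬ Keeps lead P c ((hop lead P c)^[m] v) := by
  by_contra! hcon
  have step : ∀ j ≤ 2 * q + 1, ∃ x y, lead x = lead ((hop lead P c)^[j] v) ∧
      KeepEdge lead P c x y ∧ (hop lead P c)^[j + 1] v = lead y := by
    intro j hj
    obtain ⟨x, y, hx, hxy⟩ := hcon j hj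
    exact ⟨x, y, hx, hxy, by rw [Function.iterate_succ_apply', hop_of_keepEdge hP hx hxy]⟩
  refine false_of_no_local_max (a := fun j => c ((hop lead P c)^[j] v)) (q := q)
    (fun _ _ => hq _) ?_ ?_
  · intro j hj
    obtain ⟨x, y, hx, hxy, h1⟩ := step j (by omega)
    rw [h1, hc _ _ (hlead y), ← hc _ _ hx]
    exact hproper x y hxy.1
  · intro j hj hlt
    by_contra! hgt
    obtain ⟨x, y, hx, hxy, h1⟩ := step j (by omega)
    obtain ⟨x', y', hx', hxy', h2⟩ := step (j + 1) (by omega)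
    -- A local maximum along the chain is a peak, since `prevInf` only asks for one predecessor of
    -- smaller color. Two clusters that point to each other are covered as well: their colors
    -- alternate along the chain.
    refine hxy'.2 ((IsPeak.congr hc hx').2 ⟨?_, ?_⟩)
    · rw [hP.nextInf_eq hx' hxy'.1]
      rw [show j + 2 = j + 1 + 1 from rfl, h2, hc _ _ (hlead y')] at hgt
      exact_mod_cast hgt
    · refine lt_of_le_of_lt (prevInf_le (by rw [h1, hlead]) hxy.1) ?_
      rw [hc _ _ hx]
      exact_mod_cast hlt

end Hop

/-! ### One merging phase -/

/-- The clusters of small radius. -/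
def IsActive (F : SimpleGraph V) (lead : V → V) (D : ℕ) (v : V) : Prop :=
  ∀ u, lead u = lead v → ∃ p : F.Walk u (lead u), p.length ≤ D

open Classical in
/-- The smallest key of an edge that leaves the cluster of `v`, if that cluster is active. -/
noncomputable def targetKey (G : SimpleGraph V) (key : Sym2 V → ℕ) (F : SimpleGraph V)
    (lead : V → V) (D : ℕ) (v : V) : ℕ∞ :=
  if IsActive F lead D v then clusterInf lead (outKey G key lead) v else ⊤

/-- The edge from `x` to `y` is the lightest edge that leaves the active cluster of `x`. -/
def Points (G : SimpleGraph V) (key : Sym2 V → ℕ) (F : SimpleGraph V)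
    (lead : V → V) (D : ℕ) (x y : V) : Prop :=
  G.Adj x y ∧ (key s(x, y) : ℕ∞) = targetKey G key F lead D x

section Merge

variable {G F : SimpleGraph V} {key : Sym2 V → ℕ} {lead : V → V} {D R S : ℕ}

theorem IsActive.congr {u v : V} (h : lead u = lead v) :
    IsActive F lead D u ↔ IsActive F lead D v := by
  simp only [IsActive, h]

theorem targetKey_congr {u v : V} (h : lead u = lead v) :
    targetKey G key F lead D u = targetKey G key F lead D v := by
  by_cases ha : IsActive F lead D u
  · rw [targetKey, targetKey, if_pos ha, if_pos ((IsActive.congr h).1 ha), clusterInf_congr lead _ h]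
  · rw [targetKey, targetKey, if_neg ha, if_neg ((IsActive.congr h).not.1 ha)]

theorem Points.isActive {x y : V} (h : Points G key F lead D x y) : IsActive F lead D x := by
  by_contra hn
  have := h.2
  rw [targetKey, if_neg hn] at this
  exact ENat.natCast_ne_top _ this

theorem Points.key_eq {x y : V} (h : Points G key F lead D x y) :
    (key s(x, y) : ℕ∞) = clusterInf lead (outKey G key lead) x := by
  rw [h.2, targetKey, if_pos h.isActive]

theorem exists_points {v : V} (h : targetKey G key F lead D v ≠ ⊤) :
    ∃ x y, lead x = lead v ∧ Points G key F lead D x y := by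
  have ha : IsActive F lead D v := by
    by_contra hn
    exact h (by rw [targetKey, if_neg hn])
  have h' : clusterInf lead (outKey G key lead) v ≠ ⊤ := by rwa [targetKey, if_pos ha] at h
  obtain ⟨x, hx, h1⟩ := exists_of_clusterInf_ne_top h'
  obtain ⟨y, hy, hne, h2⟩ := exists_of_outKey_ne_top (h1.trans_ne h')
  refine ⟨x, y, hx, hy, ?_⟩
  rw [h2, h1, targetKey_congr hx, targetKey, if_pos ha]

/-- `Points` does not require that the edge leaves the cluster. It does so because the minimal key
is attained by a leaving edge and keys are injective. -/
theorem Points.ne_lead (hkey : Set.InjOn key G.edgeSet) {x y : V}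
    (h : Points G key F lead D x y) : lead x ≠ lead y := by
  have h1 := h.key_eq
  obtain ⟨x', hx', h2⟩ := exists_of_clusterInf_ne_top (h1.symm.trans_ne (ENat.natCast_ne_top _))
  obtain ⟨y', hy', hne, h3⟩ := exists_of_outKey_ne_top
    (h2.trans_ne (h1.symm.trans_ne (ENat.natCast_ne_top _)))
  have : s(x, y) = s(x', y') := hkey h.1 hy' (by exact_mod_cast h1.trans (h2.symm.trans h3.symm))
  rcases Sym2.eq_iff.1 this with ⟨rfl, rfl⟩ | ⟨rfl, rfl⟩
  · exact hne.symm
  · exact absurd hx'.symm hne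

theorem isPointing_points (hkey : Set.InjOn key G.edgeSet) :
    IsPointing lead (Points G key F lead D) where
  ne _ _ h := h.ne_lead hkey
  unique x y x' y' h h' hx := by
    have h1 : (key s(x, y) : ℕ∞) = key s(x', y') := by rw [h.2, h'.2, targetKey_congr hx]
    have : s(x, y) = s(x', y') := hkey h.1 h'.1 (by exact_mod_cast h1)
    rcases Sym2.eq_iff.1 this with h2 | ⟨rfl, rfl⟩
    · exact h2
    · exact absurd hx (h.ne_lead hkey)

theorem Points.key_le {x y u w : V} (h : Points G key F lead D x y) (hu : lead u = lead x)
    (huw : G.Adj u w) (hw : lead w ≠ lead u) : key s(x, y) ≤ key s(u, w) := by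
  have h1 : (key s(x, y) : ℕ∞) ≤ key s(u, w) := by
    rw [h.key_eq]
    exact (clusterInf_le lead _ hu).trans (outKey_le huw hw)
  exact_mod_cast h1

/-- In an active cluster, the walks to the root are short and light. -/
theorem IsFragments.walk_of_isActive [Finite V] (h : IsFragments G key F lead R S)
    (hkey : Set.InjOn key G.edgeSet) {v : V} (ha : IsActive F lead D v) :
    ∃ p : F.Walk v (lead v), p.length ≤ D ∧
      ∀ e ∈ p.edges, (key e : ℕ∞) ≤ outKey G key lead v := by
  obtain ⟨p, hp⟩ := ha v rfl
  obtain ⟨q, -, hq⟩ := h.walk v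
  -- `p` is short and `q` is light. Paths in a forest are unique, so one walk has both properties.
  obtain ⟨w, hw, hwe⟩ := (h.isAcyclic hkey).exists_walk_length_le p q
  exact ⟨w, hw.trans hp, fun e he => hq e (hwe e he)⟩

/-- Some node has a simple path of more than `D` edges to its root, and all nodes of this path lie
in the cluster. -/
theorem IsFragments.lt_ncard_of_not_isActive [Finite V] (h : IsFragments G key F lead R S) {v : V}
    (ha : ¬ IsActive F lead D v) : D + 1 < {u | lead u = lead v}.ncard := by
  classical
  simp only [IsActive, not_forall, not_exists, not_le] at ha
  obtain ⟨u, hu, hD⟩ := ha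
  obtain ⟨p, -⟩ := h.walk u
  have hlen := hD p.bypass
  have h1 : p.bypass.support.toFinset.card = p.bypass.length + 1 := by
    rw [List.toFinset_card_of_nodup p.bypass_isPath.support_nodup, Walk.length_support]
  have h2 : (p.bypass.support.toFinset : Set V) ⊆ {u | lead u = lead v} := by
    intro w hw
    have hw' : w ∈ p.bypass.support := by simpa using hw
    exact ((p.bypass.takeUntil w hw').apply_eq_of_adj h.lead_eq).symm.trans hu
  have h3 := Set.ncard_le_ncard h2 (Set.toFinite _)
  rw [Set.ncard_coe_finset, h1] at h3
  omega

theorem two_mul_le_ncard_of_disjoint_fibers [Finite V] {f : V → V} {T : Set V} {a b : V}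
    (hab : f a ≠ f b) (ha : S ≤ {u | f u = f a}.ncard) (hb : S ≤ {u | f u = f b}.ncard)
    (haT : {u | f u = f a} ⊆ T) (hbT : {u | f u = f b} ⊆ T) : 2 * S ≤ T.ncard := by
  have h1 := Set.ncard_union_eq (s := {u | f u = f a}) (t := {u | f u = f b})
    (Set.disjoint_left.2 fun u hu hu' => hab (hu.symm.trans hu')) (Set.toFinite _) (Set.toFinite _)
  have h2 := Set.ncard_le_ncard (Set.union_subset haT hbT) (Set.toFinite _)
  omega

variable {c : V → ℕ} {q : ℕ}

/-- The new roots after a merging phase. -/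
noncomputable def mergeLead (lead : V → V) (P : V → V → Prop) (c : V → ℕ) (q : ℕ) : V → V :=
  (hop lead P c)^[2 * q + 2]

section

variable {P : V → V → Prop} (hP : IsPointing lead P) (hlead : ∀ v, lead (lead v) = lead v)
  (hc : ∀ u v, lead u = lead v → c u = c v) (hq : ∀ v, c v < q)
  (hproper : ∀ x y, P x y → c x ≠ c y)

include hP in
theorem mergeLead_congr {u v : V} (h : lead u = lead v) :
    mergeLead lead P c q u = mergeLead lead P c q v := by
  rw [mergeLead, Function.iterate_succ_apply _ _ u, Function.iterate_succ_apply _ _ v,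
    hop_congr hP h]

include hP hlead in
theorem mergeLead_of_not_keeps {v : V} (h : ¬ Keeps lead P c v) :
    mergeLead lead P c q v = lead v := by
  have := iterate_hop_of_not_keeps hP hlead (m := 0) h (2 * q + 1)
  rwa [show 0 + 1 + (2 * q + 1) = 2 * q + 2 by omega] at this

include hP hlead hc hq hproper

/-- Chains end after at most `2 * q + 1` hops. One further hop moves from the end of the chain to
the root of its cluster, and that root is a fixed point. -/
theorem mergeLead_spec (v : V) : ∃ m ≤ 2 * q + 1, ¬ Keeps lead P c ((hop lead P c)^[m] v) ∧
    mergeLead lead P c q v = lead ((hop lead P c)^[m] v) := by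
  obtain ⟨m, hm, hk⟩ := exists_not_keeps hP hlead hc hq hproper v
  refine ⟨m, hm, hk, ?_⟩
  rw [← iterate_hop_of_not_keeps hP hlead hk (2 * q + 1 - m), mergeLead,
    show m + 1 + (2 * q + 1 - m) = 2 * q + 2 by omega]

theorem lead_mergeLead (v : V) : lead (mergeLead lead P c q v) = mergeLead lead P c q v := by
  obtain ⟨m, -, -, h⟩ := mergeLead_spec hP hlead hc hq hproper v
  rw [h, hlead]

theorem not_keeps_mergeLead (v : V) : ¬ Keeps lead P c (mergeLead lead P c q v) := by
  obtain ⟨m, -, hk, h⟩ := mergeLead_spec hP hlead hc hq hproper v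
  rw [h, Keeps.congr (hlead _)]
  exact hk

/-- The new root is fixed by `hop`, so the additional hop from `x` to the cluster of `y` makes no
difference. -/
theorem mergeLead_eq_of_keepEdge {x y : V} (h : KeepEdge lead P c x y) :
    mergeLead lead P c q x = mergeLead lead P c q y := by
  have h1 : hop lead P c (mergeLead lead P c q x) = mergeLead lead P c q x := by
    rw [hop_of_not_keeps (not_keeps_mergeLead hP hlead hc hq hproper x),
      lead_mergeLead hP hlead hc hq hproper]
  rw [← h1, mergeLead, ← Function.iterate_succ_apply' (hop lead P c), Function.iterate_succ_apply,
    hop_of_keepEdge hP rfl h]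
  exact mergeLead_congr hP (hlead y)

theorem mergeLead_eq_of_adj {F : SimpleGraph V} (hF : ∀ u v, F.Adj u v → lead u = lead v) {u v : V}
    (h : (mergeGraph F lead P c).Adj u v) :
    mergeLead lead P c q u = mergeLead lead P c q v := by
  rcases h with h | ⟨-, h | h⟩
  · exact mergeLead_congr hP (hF _ _ h)
  · exact mergeLead_eq_of_keepEdge hP hlead hc hq hproper h
  · exact (mergeLead_eq_of_keepEdge hP hlead hc hq hproper h).symm

end

/-- A hop starts in an active cluster: `D` edges to its root, `D` edges from there to the exit `x`,
and the pointer itself. Only the last cluster, which may be inactive, costs `R`. The walk stays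
light because the pointer is the lightest edge leaving the cluster of `v`, hence at most `outKey` of
`v`, while as an edge leaving the cluster of `y` it is at least `outKey` of `y`. -/
theorem IsFragments.exists_walk_iterate_hop [Finite V] (h : IsFragments G key F lead R S)
    (hkey : Set.InjOn key G.edgeSet) (m : ℕ) (v : V)
    (hk : ¬ Keeps lead (Points G key F lead D) c ((hop lead (Points G key F lead D) c)^[m] v)) :
    ∃ p : (mergeGraph F lead (Points G key F lead D) c).Walk v
        (lead ((hop lead (Points G key F lead D) c)^[m] v)),
      p.length ≤ m * (2 * D + 1) + R ∧ ∀ e ∈ p.edges, (key e : ℕ∞) ≤ outKey G key lead v := by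
  have hP := isPointing_points (F := F) (lead := lead) (D := D) hkey
  set P := Points G key F lead D
  have hF : F ≤ mergeGraph F lead P c := le_sup_left
  have base : ∃ p : (mergeGraph F lead P c).Walk v (lead v), p.length ≤ R ∧
      ∀ e ∈ p.edges, (key e : ℕ∞) ≤ outKey G key lead v := by
    obtain ⟨p, hp, he⟩ := h.walk v
    exact ⟨p.mapLe hF, by simpa using hp, by simpa using he⟩
  induction m generalizing v with
  | zero => simpa using base
  | succ m ih =>
    by_cases hkv : Keeps lead P c v
    · obtain ⟨x, y, hx, hxy⟩ := hkv
      have hhop := hop_of_keepEdge hP hx hxy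
      have hcongr := lead_iterate_hop_congr (c := c) hP (h.lead_lead y) m
      have hk' : ¬ Keeps lead P c ((hop lead P c)^[m] y) := by
        rw [Function.iterate_succ_apply, hhop, Keeps.congr hcongr] at hk
        exact hk
      obtain ⟨p, hp, hpe⟩ := ih y hk' (by
        obtain ⟨p, hp, he⟩ := h.walk y
        exact ⟨p.mapLe hF, by simpa using hp, by simpa using he⟩)
      have hax : IsActive F lead D x := hxy.1.isActive
      obtain ⟨p1, hp1, hpe1⟩ := h.walk_of_isActive hkey ((IsActive.congr hx).1 hax)
      obtain ⟨p2, hp2, hpe2⟩ := h.walk_of_isActive hkey hax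
      have hlxy : lead x ≠ lead y := hP.ne x y hxy.1
      have hkv : (key s(x, y) : ℕ∞) ≤ outKey G key lead v := by
        rw [hxy.1.key_eq]
        exact clusterInf_le lead _ hx.symm
      have hky : outKey G key lead y ≤ key s(x, y) := by
        rw [Sym2.eq_swap]
        exact outKey_le hxy.1.1.symm hlxy
      have hadj := mergeGraph_adj_of_keepEdge hP F hxy
      have hend : lead ((hop lead P c)^[m] y) = lead ((hop lead P c)^[m + 1] v) := by
        rw [Function.iterate_succ_apply, hhop, hcongr]
      rw [← hend]
      refine ⟨(p1.mapLe hF).append (((p2.reverse.copy hx rfl).mapLe hF).append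
        (Walk.cons hadj p)), ?_, ?_⟩
      · simp
        nlinarith
      · intro e he
        simp only [Walk.edges_append, Walk.edges_mapLe_eq_edges, Walk.edges_copy,
          Walk.edges_reverse, Walk.edges_cons, List.mem_append, List.mem_reverse,
          List.mem_cons] at he
        rcases he with he | he | rfl | he
        · exact hpe1 e he
        · exact (hpe2 e he).trans ((outKey_le hxy.1.1 hlxy.symm).trans hkv)
        · exact hkv
        · exact (hpe e he).trans (hky.trans hkv)
    · have hend : lead ((hop lead P c)^[m + 1] v) = lead v := by
        have := iterate_hop_of_not_keeps hP h.lead_lead (m := 0) hkv m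
        rw [add_comm m 1, ← zero_add 1, this]
        exact h.lead_lead v
      obtain ⟨p, hp, he⟩ := base
      rw [hend]
      exact ⟨p, by nlinarith, he⟩

/-- A merging phase doubles the sizes of the clusters. -/
theorem IsFragments.merge [Finite V] (h : IsFragments G key F lead R S)
    (hkey : Set.InjOn key G.edgeSet) (hSD : 2 * S ≤ D)
    (hc : ∀ u v, lead u = lead v → c u = c v) (hq : ∀ v, c v < q)
    (hproper : ∀ x y, Points G key F lead D x y → c x ≠ c y) :
    IsFragments G key (mergeGraph F lead (Points G key F lead D) c)
      (mergeLead lead (Points G key F lead D) c q) ((2 * q + 1) * (2 * D + 1) + R) (2 * S) := by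
  have hP := isPointing_points (F := F) (lead := lead) (D := D) hkey
  have hlead := h.lead_lead
  have hwalk : ∀ v, ∃ p : (mergeGraph F lead (Points G key F lead D) c).Walk v
      (mergeLead lead (Points G key F lead D) c q v),
      p.length ≤ (2 * q + 1) * (2 * D + 1) + R ∧
        ∀ e ∈ p.edges, (key e : ℕ∞) ≤ outKey G key lead v := by
    intro v
    obtain ⟨m, hm, hk, hml⟩ := mergeLead_spec hP hlead hc hq hproper v
    obtain ⟨p, hp, he⟩ := h.exists_walk_iterate_hop hkey m v hk
    rw [hml]
    have := Nat.mul_le_mul_right (2 * D + 1) hm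
    exact ⟨p, by omega, he⟩
  have hcong : ∀ u v, lead u = lead v → mergeLead lead (Points G key F lead D) c q u =
      mergeLead lead (Points G key F lead D) c q v := fun u v => mergeLead_congr hP
  have hout : ∀ u v, G.Adj u v → lead v ≠ lead u → outKey G key lead u ≠ ⊤ := fun u v huv hne =>
    ne_top_of_le_ne_top (ENat.natCast_ne_top _) (outKey_le huv hne)
  have hsize : ∀ u v, G.Adj u v → lead v ≠ lead u → S ≤ {w | lead w = lead u}.ncard := by
    intro u v huv hne
    exact h.size u (ne_top_of_le_ne_top (hout u v huv hne) (clusterInf_le lead _ rfl))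
  have hpair : ∀ x y, KeepEdge lead (Points G key F lead D) c x y →
      2 * S ≤ {u | mergeLead lead (Points G key F lead D) c q u =
        mergeLead lead (Points G key F lead D) c q x}.ncard := by
    intro x y hxy
    have hne := hP.ne x y hxy.1
    refine two_mul_le_ncard_of_disjoint_fibers hne (hsize x y hxy.1.1 hne.symm)
      (hsize y x hxy.1.1.symm hne) (fun u hu => hcong u x hu) (fun u hu => ?_)
    exact (hcong u y hu).trans (mergeLead_eq_of_keepEdge hP hlead hc hq hproper hxy).symm
  refine ⟨?_, ?_, ?_, ?_, ?_, ?_⟩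
  · refine sup_le h.le ?_
    rintro u v ⟨-, h | h⟩
    · exact h.1.1
    · exact h.1.1.symm
  · exact fun u v => mergeLead_eq_of_adj hP hlead hc hq hproper h.lead_eq
  · intro v
    obtain ⟨p, hp, he⟩ := hwalk v
    -- An edge that leaves the new cluster also leaves the old one, so `outKey` does not decrease.
    refine ⟨p, hp, fun e hep => (he e hep).trans ?_⟩
    refine le_iInf₂ fun u hu => outKey_le hu.1 fun huv => hu.2 (hcong _ _ huv)
  · intro u v huv hl
    by_cases hluv : lead u = lead v
    · obtain ⟨p, hp, he⟩ := h.inner u v huv hluv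
      have hF : F ≤ mergeGraph F lead (Points G key F lead D) c := le_sup_left
      exact ⟨p.mapLe hF, by simp; omega, by simpa using he⟩
    -- Before the merge, the edge from `u` to `v` left both old clusters. So it bounds the old
    -- `outKey` of both ends, and with it both walks to the common new root.
    · obtain ⟨p, hp, hpe⟩ := hwalk u
      obtain ⟨p', hp', hpe'⟩ := hwalk v
      refine ⟨p.append (p'.reverse.copy hl.symm rfl), by simp; omega, ?_⟩
      intro e he
      simp only [Walk.edges_append, Walk.edges_copy, Walk.edges_reverse, List.mem_append,
        List.mem_reverse] at he
      have : (key e : ℕ∞) ≤ key s(u, v) := by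
        rcases he with he | he
        · exact (hpe e he).trans (outKey_le huv (Ne.symm hluv))
        · rw [Sym2.eq_swap]
          exact (hpe' e he).trans (outKey_le huv.symm hluv)
      exact_mod_cast this
  · have hnew : ∀ x y, KeepEdge lead (Points G key F lead D) c x y →
        ∃ S : Set V, (∃ a b, s(x, y) = s(a, b) ∧ a ∈ S ∧ b ∉ S) ∧
          ∀ u v, G.Adj u v → u ∈ S → v ∉ S → key s(x, y) ≤ key s(u, v) := by
      intro x y hxy
      refine ⟨{u | lead u = lead x}, ⟨x, y, rfl, rfl, (hP.ne x y hxy.1).symm⟩, ?_⟩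
      intro u v huv hu hv
      exact hxy.1.key_le hu huv fun e => hv (e.trans hu)
    intro e
    induction e with | _ x y =>
    rintro (hxy | ⟨-, hxy | hxy⟩)
    · exact h.cut _ hxy
    · exact hnew x y hxy
    · rw [Sym2.eq_swap]; exact hnew y x hxy
  · intro v hv
    obtain ⟨u, hu, hu'⟩ := exists_of_clusterInf_ne_top hv
    obtain ⟨w, huw, hne, -⟩ := exists_of_outKey_ne_top (hu'.trans_ne hv)
    have hluw : lead w ≠ lead u := fun e => hne (hcong _ _ e)
    rw [← hu]
    by_cases ha : IsActive F lead D u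
    · obtain ⟨x, y, hx, hxy⟩ := exists_points (G := G) (key := key) (F := F) (lead := lead)
        (D := D) (v := u) (by
          rw [targetKey, if_pos ha]
          exact ne_top_of_le_ne_top (hout u w huw hluw) (clusterInf_le lead _ rfl))
      rw [← hcong x u hx]
      by_cases hcut : IsPeak lead (Points G key F lead D) c x
      -- A peak drops its own pointer, but some cluster of smaller color points to it. That cluster
      -- has a successor of larger color, so it is not a peak and its pointer is kept.
      · obtain ⟨x', y', hy', hxy', hlt⟩ := exists_of_prevInf_ne_top hcut.2.ne_top
        have hk : KeepEdge lead (Points G key F lead D) c x' y' := by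
          refine ⟨hxy', fun hcon => ?_⟩
          have h1 := hcon.1
          have h2 := hcut.2
          rw [hP.nextInf_eq rfl hxy', hc _ _ hy'] at h1
          rw [← hlt] at h2
          exact lt_asymm h1 h2
        rw [← hcong y' x hy', ← mergeLead_eq_of_keepEdge hP hlead hc hq hproper hk]
        exact hpair x' y' hk
      · exact hpair x y ⟨hxy, hcut⟩
    · have h1 := h.lt_ncard_of_not_isActive ha
      have h2 : {w | lead w = lead u}.ncard ≤ {w | mergeLead lead (Points G key F lead D) c q w =
          mergeLead lead (Points G key F lead D) c q u}.ncard :=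
        Set.ncard_le_ncard (fun w hw => hcong w u hw) (Set.toFinite _)
      omega

end Merge

/-! ### Cole-Vishkin color reduction -/

/-- The Cole-Vishkin step: the position and the value of the first bit in which the color `a`
differs from the color `b`. -/
noncomputable def cvStep (a : ℕ) (b : ℕ∞) : ℕ :=
  2 * sInf {i | ∃ b' : ℕ, b = b' ∧ a.testBit i ≠ b'.testBit i} +
    (a.testBit (sInf {i | ∃ b' : ℕ, b = b' ∧ a.testBit i ≠ b'.testBit i})).toNat

theorem cvStep_lt {a m : ℕ} {b : ℕ∞} (ha : a < 2 ^ m) (hb : ∀ b' : ℕ, b = b' → b' < 2 ^ m)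
    (hm : 1 ≤ m) : cvStep a b < 2 * m := by
  have hi : sInf {i | ∃ b' : ℕ, b = b' ∧ a.testBit i ≠ b'.testBit i} < m := by
    rcases Set.eq_empty_or_nonempty {i | ∃ b' : ℕ, b = b' ∧ a.testBit i ≠ b'.testBit i} with h | h
    -- If no bit differs, for instance because there is no successor, the position defaults to `0`.
    · rw [h, Nat.sInf_empty]; exact hm
    · obtain ⟨b', hb', hne⟩ := Nat.sInf_mem h
      by_contra! hle
      have h2 := Nat.pow_le_pow_right (n := 2) (by norm_num) hle
      rw [Nat.testBit_lt_two_pow (ha.trans_le h2),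
        Nat.testBit_lt_two_pow ((hb b' hb').trans_le h2)] at hne
      exact hne rfl
  have := Bool.toNat_le (a.testBit (sInf {i | ∃ b' : ℕ, b = b' ∧ a.testBit i ≠ b'.testBit i}))
  unfold cvStep
  omega

/-- Equal results would name the same position and the same bit of `a` and `b` there. But the
position computed for `a` is one in which `a` and `b` differ. -/
theorem cvStep_ne {a b : ℕ} (h : a ≠ b) (d : ℕ∞) : cvStep a b ≠ cvStep b d := by
  have hne : {i | ∃ b' : ℕ, (b : ℕ∞) = b' ∧ a.testBit i ≠ b'.testBit i}.Nonempty := by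
    obtain ⟨i, hi⟩ := Nat.exists_testBit_ne_of_ne h
    exact ⟨i, b, rfl, hi⟩
  obtain ⟨b', hb', hbit⟩ := Nat.sInf_mem hne
  obtain rfl : b = b' := by exact_mod_cast hb'
  unfold cvStep
  intro heq
  have h1 := Bool.toNat_le (a.testBit (sInf {i | ∃ b' : ℕ, (b : ℕ∞) = b' ∧
    a.testBit i ≠ b'.testBit i}))
  have h2 := Bool.toNat_le (b.testBit (sInf {i | ∃ b' : ℕ, d = b' ∧ b.testBit i ≠ b'.testBit i}))
  have h3 : sInf {i | ∃ b' : ℕ, (b : ℕ∞) = b' ∧ a.testBit i ≠ b'.testBit i} =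
    sInf {i | ∃ b' : ℕ, d = b' ∧ b.testBit i ≠ b'.testBit i} := by omega
  rw [← h3] at heq
  refine hbit ?_
  have h4 : (a.testBit (sInf {i | ∃ b' : ℕ, (b : ℕ∞) = b' ∧ a.testBit i ≠ b'.testBit i})).toNat =
    (b.testBit (sInf {i | ∃ b' : ℕ, (b : ℕ∞) = b' ∧ a.testBit i ≠ b'.testBit i})).toNat := by omega
  revert h4
  cases a.testBit _ <;> cases b.testBit _ <;> simp

section CV

variable {V L : Type} {lead : V → L} {P : V → V → Prop} {c : V → ℕ}

/-- The colors after repeated Cole-Vishkin steps. -/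
noncomputable def cvColor (lead : V → L) (P : V → V → Prop) (c : V → ℕ) : ℕ → V → ℕ
  | 0 => c
  | j + 1 => fun v => cvStep (cvColor lead P c j v) (nextInf lead P (cvColor lead P c j) v)

theorem cvColor_congr (hc : ∀ u v, lead u = lead v → c u = c v) (j : ℕ) (u v : V)
    (h : lead u = lead v) : cvColor lead P c j u = cvColor lead P c j v := by
  induction j with
  | zero => exact hc u v h
  | succ j ih =>
    simp only [cvColor, ih]
    rw [nextInf, nextInf, clusterInf_congr lead _ h]

theorem cvColor_ne (hP : IsPointing lead P) (hproper : ∀ x y, P x y → c x ≠ c y) (j : ℕ) (x y : V)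
    (h : P x y) : cvColor lead P c j x ≠ cvColor lead P c j y := by
  induction j with
  | zero => exact hproper x y h
  | succ j ih =>
    simp only [cvColor]
    rw [hP.nextInf_eq rfl h]
    exact cvStep_ne ih _

/-- The number of colors after repeated Cole-Vishkin steps. -/
def paletteSize (p : ℕ) (j : ℕ) : ℕ := (fun p => 2 * Nat.clog 2 p)^[j] p

theorem two_le_paletteSize {p : ℕ} (hp : 2 ≤ p) (j : ℕ) : 2 ≤ paletteSize p j := by
  induction j with
  | zero => exact hp
  | succ j ih =>
    rw [paletteSize, Function.iterate_succ_apply']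
    have := Nat.clog_pos (b := 2) (by norm_num) (show 1 < paletteSize p j by omega)
    simp only [paletteSize] at this ⊢
    omega

/-- A small palette can grow in a step, for example from 3 to 4, but never beyond the bound `b`.
This keeps all intermediate colors within the message size. -/
theorem paletteSize_le {p b : ℕ} (hp : p ≤ b) (hb : 6 ≤ b) (j : ℕ) : paletteSize p j ≤ b := by
  induction j with
  | zero => exact hp
  | succ j ih =>
    rw [paletteSize, Function.iterate_succ_apply']
    have hpow : ∀ y, 3 ≤ y → 2 * y + 1 ≤ 2 ^ y := by
      intro y hy
      induction y, hy using Nat.le_induction with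
      | base => norm_num
      | succ y hy ih => rw [pow_succ]; omega
    have h1 := hpow (b / 2) (by omega)
    have h2 : Nat.clog 2 (paletteSize p j) ≤ b / 2 := Nat.clog_le_of_le_pow (by omega)
    simp only [paletteSize] at h2
    omega

theorem cvColor_lt {p : ℕ} (hp : 2 ≤ p) (hc : ∀ v, c v < p) (j : ℕ) (v : V) :
    cvColor lead P c j v < paletteSize p j := by
  induction j generalizing v with
  | zero => exact hc v
  | succ j ih =>
    have h2 := two_le_paletteSize hp j
    rw [paletteSize, Function.iterate_succ_apply']
    have hlt : ∀ v, cvColor lead P c j v < 2 ^ Nat.clog 2 (paletteSize p j) := fun v =>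
      (ih v).trans_le (Nat.le_pow_clog (by norm_num) _)
    refine cvStep_lt (hlt v) ?_ (Nat.clog_pos (by norm_num) h2)
    intro b hb
    obtain ⟨x, y, -, -, he⟩ := exists_of_nextInf_ne_top (hb.trans_ne (ENat.natCast_ne_top b))
    have : cvColor lead P c j y = b := by exact_mod_cast he.trans hb
    exact this ▸ hlt y

end CV

theorem clog_two_mul_le (x y : ℕ) : Nat.clog 2 (x * y) ≤ Nat.clog 2 x + Nat.clog 2 y := by
  refine Nat.clog_le_of_le_pow ?_
  rw [pow_add]
  exact Nat.mul_le_mul (Nat.le_pow_clog (by norm_num) x) (Nat.le_pow_clog (by norm_num) y)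

theorem clog_two_pow_le (x k : ℕ) : Nat.clog 2 (x ^ k) ≤ k * Nat.clog 2 x := by
  refine Nat.clog_le_of_le_pow ?_
  rw [mul_comm, pow_mul]
  exact Nat.pow_le_pow_left (Nat.le_pow_clog (by norm_num) x) k

theorem iterate_clog_logStar_le_one (n : ℕ) : (Nat.clog 2)^[logStar n] n ≤ 1 := by
  refine Nat.sInf_mem (s := {j : ℕ | (Nat.clog 2)^[j] n ≤ 1}) ?_
  induction n using Nat.strong_induction_on with
  | _ n ih =>
    by_cases hn : n ≤ 1
    · exact ⟨0, hn⟩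
    · have : Nat.clog 2 n < n := by
        have h1 : n ≤ 2 ^ (n - 1) := by
          have := Nat.lt_two_pow_self (n := n - 1)
          omega
        have := Nat.clog_le_of_le_pow h1
        omega
      obtain ⟨j, hj⟩ := ih _ this
      exact ⟨j + 1, hj⟩

theorem one_le_logStar {n : ℕ} (hn : 2 ≤ n) : 1 ≤ logStar n := by
  by_contra! h
  have := iterate_clog_logStar_le_one n
  rw [Nat.lt_one_iff.1 h] at this
  simp at this
  omega

theorem logStar_of_le_one {n : ℕ} (hn : n ≤ 1) : logStar n = 0 :=
  Nat.sInf_eq_zero.2 (Or.inl hn)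

/-- After `log* n` Cole-Vishkin steps, the number of colors is bounded. -/
theorem paletteSize_logStar_le {n k : ℕ} (hn : 2 ≤ n) :
    paletteSize (n ^ k) (logStar n) ≤ 2 ^ (k + 4) := by
  have hK : 2 * (k + 4) + 2 ≤ 2 ^ (k + 4) := by
    induction k with
    | zero => norm_num
    | succ k ih => rw [show k + 1 + 4 = k + 4 + 1 by omega, pow_succ]; omega
  have hclog : Nat.clog 2 (2 ^ (k + 4)) = k + 4 := Nat.clog_pow 2 _ (by norm_num)
  -- The palette stays within a constant factor of the iterated logarithm of `n`: the logarithm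
  -- turns the factor `2 ^ (k + 4)` into the summand `k + 4`, which `hK` absorbs again.
  have main : ∀ j, paletteSize (n ^ k) (j + 1) ≤
      2 ^ (k + 4) * max 1 ((Nat.clog 2)^[j + 1] n) := by
    intro j
    induction j with
    | zero =>
      have h1 := clog_two_pow_le n k
      have h2 : k * Nat.clog 2 n ≤ k * max 1 (Nat.clog 2 n) :=
        Nat.mul_le_mul_left k (le_max_right _ _)
      simp only [paletteSize, zero_add, Function.iterate_one]
      have : 2 * k * max 1 (Nat.clog 2 n) ≤ 2 ^ (k + 4) * max 1 (Nat.clog 2 n) :=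
        Nat.mul_le_mul_right _ (by omega)
      nlinarith
    | succ j ih =>
      rw [paletteSize, Function.iterate_succ_apply', Function.iterate_succ_apply' (Nat.clog 2)]
      rw [paletteSize] at ih
      generalize (fun p => 2 * Nat.clog 2 p)^[j + 1] (n ^ k) = p at ih
      generalize (Nat.clog 2)^[j + 1] n = a at ih
      have h1 := (Nat.clog_mono_right 2 ih).trans (clog_two_mul_le _ _)
      rw [hclog] at h1
      have h2 : Nat.clog 2 (max 1 a) ≤ Nat.clog 2 a := by
        rcases le_total 1 a with h | h
        · rw [max_eq_right h]
        · rw [max_eq_left h, Nat.clog_one_right]; exact Nat.zero_le _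
      rcases Nat.eq_zero_or_pos (Nat.clog 2 a) with h0 | hpos
      · simp [h0] at h2 ⊢
        omega
      · rw [max_eq_right hpos]
        have : 2 ^ (k + 4) * Nat.clog 2 a ≥ (2 * (k + 4) + 2) * Nat.clog 2 a :=
          Nat.mul_le_mul_right _ hK
        nlinarith
  have h1 := main (logStar n - 1)
  rw [Nat.sub_add_cancel (one_le_logStar hn), max_eq_left (iterate_clog_logStar_le_one n)] at h1
  simpa using h1

/-! ### The stretch of the combined spanner -/

namespace WeightedGraph

variable {V : Type} {W : WeightedGraph V}

theorem dist_le_length {u v : V} (p : W.graph.Walk u v) : W.dist u v ≤ W.length p := iInf_le _ p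

theorem dist_triangle (u v w : V) : W.dist u w ≤ W.dist u v + W.dist v w := by
  unfold dist
  refine ENNReal.le_iInf_add_iInf fun p q => ?_
  refine (iInf_le _ (p.append q)).trans ?_
  simp [length, SimpleGraph.Walk.edges_append]

theorem dist_self (u : V) : W.dist u u = 0 :=
  le_antisymm ((dist_le_length (Walk.nil : W.graph.Walk u u)).trans (by simp [length])) zero_le

theorem dist_comm_le (u v : V) : W.dist u v ≤ W.dist v u := by
  refine le_iInf fun p => (dist_le_length p.reverse).trans ?_
  simp [length]

theorem dist_le_of_adj {u v : V} (h : W.graph.Adj u v) : W.dist u v ≤ W.weight s(u, v) :=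
  (dist_le_length (Walk.cons h Walk.nil)).trans (by simp [length])

theorem dist_le_of_walk {F : SimpleGraph V} (hF : F ≤ W.graph) {u v : V} (p : F.Walk u v)
    {m w : ℕ} (hp : p.length ≤ m) (hw : ∀ e ∈ p.edges, W.weight e ≤ w) :
    W.dist u v ≤ m * w := by
  refine (dist_le_length (p.mapLe hF)).trans ?_
  have h1 : W.length (p.mapLe hF) ≤ p.length * w := by
    have := List.sum_le_card_nsmul (p.edges.map W.weight) w (by simpa using hw)
    simpa [length] using this
  have h2 : W.length (p.mapLe hF) ≤ m * w := h1.trans (Nat.mul_le_mul_right _ hp)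
  exact_mod_cast h2

/-- The stretch is determined by the distances of adjacent nodes. -/
theorem hasStretch_of_adj {H : WeightedGraph V} {α : ℝ} (hα : 0 < α)
    (h : ∀ u v, W.graph.Adj u v → H.dist u v ≤ ENNReal.ofReal α * W.weight s(u, v)) :
    H.HasStretch W α := by
  intro u v
  change H.dist u v ≤ ENNReal.ofReal α * ⨅ p : W.graph.Walk u v, (W.length p : ℝ≥0∞)
  rw [ENNReal.mul_iInf_of_ne (by simpa using hα) ENNReal.ofReal_ne_top]
  refine le_iInf fun p => ?_
  induction p with
  | nil => simp [dist_self]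
  | cons e p ih =>
    refine (dist_triangle _ _ _).trans ((add_le_add (h _ _ e) ih).trans ?_)
    rw [← mul_add]
    simp [length]

end WeightedGraph

section Stretch

variable {V : Type} {W : WeightedGraph V} {F A : SimpleGraph V} {key : Sym2 V → ℕ} {lead : V → V}
  {R S r : ℕ} {K : Clustering W.graph r} {α : ℝ}

/-- An edge that leaves the cluster at `u` is at least `outKey` of `u`, so it is at least as heavy
as each of the at most `R` tree edges to the root. -/
theorem dist_lead_le {H : WeightedGraph V} (h : IsFragments W.graph key F lead R S)
    (hkey : ∀ e f, e ∈ W.graph.edgeSet → f ∈ W.graph.edgeSet → key e ≤ key f →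
      W.weight e ≤ W.weight f) (hH : F ≤ H.graph) (hw : H.weight = W.weight)
    {u v : V} (huv : W.graph.Adj u v) (hne : lead u ≠ lead v) :
    H.dist u (lead u) ≤ R * W.weight s(u, v) := by
  obtain ⟨p, hp, he⟩ := h.walk u
  refine WeightedGraph.dist_le_of_walk hH p hp fun e hep => ?_
  rw [hw]
  refine hkey _ _ (edgeSet_mono h.le (p.edges_subset_edgeSet hep)) huv ?_
  exact_mod_cast (he e hep).trans (outKey_le huv hne.symm)

/-- Walks in the cluster graph give walks between the roots. -/
theorem dist_lead_lead_le {H : WeightedGraph V} (h : IsFragments W.graph key F lead R S)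
    (hkey : ∀ e f, e ∈ W.graph.edgeSet → f ∈ W.graph.edgeSet → key e ≤ key f →
      W.weight e ≤ W.weight f) (hH : F ≤ H.graph) (hw : H.weight = W.weight)
    (hA : A ≤ H.graph) (hAW : A ≤ W.graph) (hroot : ∀ v ∈ K.nodes, K.root v = lead v)
    {c d : K.Node} (p : (K.contract (W.restrict A)).graph.Walk c d) :
    H.dist c.1 d.1 ≤ (2 * R + 1) * (K.contract (W.restrict A)).length p := by
  induction p with
  | nil => simp [WeightedGraph.dist_self]
  | @cons c d d' e p ih =>
    have hlen : (K.contract (W.restrict A)).length (Walk.cons e p) =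
        (K.contract (W.restrict A)).weight s(c, d) + (K.contract (W.restrict A)).length p := by
      simp [WeightedGraph.length]
    rw [hlen]
    obtain ⟨hcd, u₀, hu₀, v₀, hv₀, ha₀, hru₀, hrv₀⟩ := e
    -- The weight of a contracted edge is attained by an edge of `A`. That edge is extended by the
    -- tree walks from its ends to the roots, at a cost of `R + 1 + R` times its weight.
    have hmem := Nat.sInf_mem (s := {x : ℕ | ∃ u ∈ K.nodes, ∃ v ∈ K.nodes,
      (W.restrict A).graph.Adj u v ∧ s(c, d).map Subtype.val = s(K.root u, K.root v) ∧
        x = (W.restrict A).weight s(u, v)})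
      ⟨_, u₀, hu₀, v₀, hv₀, ha₀, by rw [hru₀, hrv₀]; rfl, rfl⟩
    have key1 : H.dist c.1 d.1 ≤
        (2 * R + 1) * ((K.contract (W.restrict A)).weight s(c, d) : ℝ≥0∞) := by
      obtain ⟨u, hu, v, hv, ha, hr, hx⟩ := hmem
      change H.dist c.1 d.1 ≤ (2 * R + 1) * ((sInf _ : ℕ) : ℝ≥0∞)
      rw [hx]
      change H.dist c.1 d.1 ≤ (2 * R + 1) * (W.weight s(u, v) : ℝ≥0∞)
      rw [hroot u hu, hroot v hv, Sym2.map_mk] at hr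
      have hne : lead u ≠ lead v := by
        intro hluv
        rw [hluv] at hr
        rcases Sym2.eq_iff.1 hr with ⟨h1, h2⟩ | ⟨h1, h2⟩
        · exact hcd (Subtype.ext (h1.trans h2.symm))
        · exact hcd (Subtype.ext (h1.trans h2.symm))
      have key2 : ∀ u v, A.Adj u v → lead u ≠ lead v →
          H.dist (lead u) (lead v) ≤ (2 * R + 1) * (W.weight s(u, v) : ℝ≥0∞) := by
        intro u v ha hne
        have h1 := dist_lead_le h hkey hH hw (hAW ha) hne
        have h2 := dist_lead_le h hkey hH hw (hAW ha).symm hne.symm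
        have h3 := WeightedGraph.dist_le_of_adj (hA ha)
        rw [hw] at h3
        rw [Sym2.eq_swap] at h2
        calc H.dist (lead u) (lead v)
            ≤ H.dist (lead u) u + (H.dist u v + H.dist v (lead v)) :=
              (WeightedGraph.dist_triangle _ u _).trans
                (add_le_add le_rfl (WeightedGraph.dist_triangle _ v _))
          _ ≤ R * (W.weight s(u, v) : ℝ≥0∞) +
              ((W.weight s(u, v) : ℝ≥0∞) + R * (W.weight s(u, v) : ℝ≥0∞)) :=
              add_le_add ((WeightedGraph.dist_comm_le _ _).trans h1) (add_le_add h3 h2)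
          _ = _ := by ring
      rcases Sym2.eq_iff.1 hr with ⟨h1, h2⟩ | ⟨h1, h2⟩
      · rw [h1, h2]; exact key2 u v ha hne
      · rw [h1, h2, Sym2.eq_swap]; exact key2 v u ha.symm hne.symm
    refine (WeightedGraph.dist_triangle _ d.1 _).trans ((add_le_add key1 ih).trans ?_)
    rw [← mul_add]
    simp

/-- A spanner of the cluster graph and the forest give a spanner. -/
theorem isSpanner_sup (h : IsFragments W.graph key F lead R S)
    (hkey : ∀ e f, e ∈ W.graph.edgeSet → f ∈ W.graph.edgeSet → key e ≤ key f →
      W.weight e ≤ W.weight f) (hroot : ∀ v ∈ K.nodes, K.root v = lead v)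
    (hparent : ∀ v ∈ K.nodes, lead v ∈ K.nodes ∧ K.parent (lead v) = lead v)
    (hnodes : ∀ u v, W.graph.Adj u v → lead u ≠ lead v → u ∈ K.nodes)
    (hα : 1 ≤ α) (hA : K.IsSpanner W A α) : W.IsSpanner (F ⊔ A) ((4 * R + 1) * α) := by
  refine ⟨sup_le h.le hA.1, ?_⟩
  have hF' : F ≤ (W.restrict (F ⊔ A)).graph := le_sup_left
  have hA' : A ≤ (W.restrict (F ⊔ A)).graph := le_sup_right
  have hα1 : (1 : ℝ≥0∞) ≤ ENNReal.ofReal α := by simpa using hα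
  have hof : ENNReal.ofReal ((4 * R + 1) * α) = (4 * R + 1) * ENNReal.ofReal α := by
    rw [ENNReal.ofReal_mul (by positivity), ENNReal.ofReal_add (by positivity) (by norm_num),
      ENNReal.ofReal_mul (by norm_num)]
    simp
  refine WeightedGraph.hasStretch_of_adj (by positivity) fun u v huv => ?_
  rw [hof]
  by_cases hl : lead u = lead v
  · obtain ⟨p, hp, he⟩ := h.inner u v huv hl
    refine (WeightedGraph.dist_le_of_walk hF' p hp (w := W.weight s(u, v)) fun e hep =>
      hkey _ _ (edgeSet_mono h.le (p.edges_subset_edgeSet hep)) huv (he e hep)).trans ?_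
    refine mul_le_mul_left ?_ _
    calc ((2 * R : ℕ) : ℝ≥0∞) ≤ ((4 * R + 1 : ℕ) : ℝ≥0∞) := by
          exact_mod_cast (by omega : 2 * R ≤ 4 * R + 1)
      _ = (4 * R + 1) * 1 := by push_cast; ring
      _ ≤ _ := mul_le_mul_right hα1 _
  · have hu := hnodes u v huv hl
    have hv := hnodes v u huv.symm (Ne.symm hl)
    let c : K.Node := ⟨lead u, hparent u hu⟩
    let d : K.Node := ⟨lead v, hparent v hv⟩
    have hcd : (K.contract W).graph.Adj c d :=
      ⟨fun e => hl (congrArg Subtype.val e), u, hu, v, hv, huv, hroot u hu, hroot v hv⟩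
    have hwt : (K.contract W).weight s(c, d) ≤ W.weight s(u, v) := by
      refine Nat.sInf_le ⟨u, hu, v, hv, huv, ?_, rfl⟩
      rw [hroot u hu, hroot v hv]; rfl
    have h1 : (K.contract (W.restrict A)).dist c d ≤ ENNReal.ofReal α * W.weight s(u, v) := by
      refine (hA.2.2 c d).trans (mul_le_mul_right ?_ _)
      exact (WeightedGraph.dist_le_of_adj hcd).trans (by exact_mod_cast hwt)
    have h2 : (W.restrict (F ⊔ A)).dist (lead u) (lead v) ≤
        (2 * R + 1) * (K.contract (W.restrict A)).dist c d := by
      unfold WeightedGraph.dist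
      rw [ENNReal.mul_iInf_of_ne (by positivity) (by finiteness)]
      exact le_iInf fun p => dist_lead_lead_le h hkey hF' rfl hA' hA.1 hroot p
    have h3 := dist_lead_le (H := W.restrict (F ⊔ A)) h hkey hF' rfl huv hl
    have h4 := dist_lead_le (H := W.restrict (F ⊔ A)) h hkey hF' rfl huv.symm (Ne.symm hl)
    rw [Sym2.eq_swap] at h4
    -- The tree walks at the two ends are charged with the factor `α` as well, so that the total is
    -- exactly `(4 * R + 1) * α`.
    have h5 : (W.weight s(u, v) : ℝ≥0∞) ≤ ENNReal.ofReal α * W.weight s(u, v) :=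
      le_mul_of_one_le_left zero_le hα1
    calc (W.restrict (F ⊔ A)).dist u v
        ≤ (W.restrict (F ⊔ A)).dist u (lead u) +
          ((W.restrict (F ⊔ A)).dist (lead u) (lead v) +
            (W.restrict (F ⊔ A)).dist (lead v) v) :=
          (WeightedGraph.dist_triangle _ (lead u) _).trans
            (add_le_add le_rfl (WeightedGraph.dist_triangle _ (lead v) _))
      _ ≤ R * (ENNReal.ofReal α * W.weight s(u, v)) +
          ((2 * R + 1) * (ENNReal.ofReal α * W.weight s(u, v)) +
            R * (ENNReal.ofReal α * W.weight s(u, v))) := by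
          refine add_le_add (h3.trans (mul_le_mul_right h5 _)) (add_le_add
            (h2.trans (mul_le_mul_right h1 _)) ?_)
          exact (WeightedGraph.dist_comm_le _ _).trans (h4.trans (mul_le_mul_right h5 _))
      _ = _ := by ring

end Stretch

/-! ### What the processors can find out in a given number of rounds -/

namespace Network

variable {n k : ℕ} (net : Network n k)

theorem fromNbrs_eq_some {v : Fin n} {f : Fin n → ℕ} {i a : ℕ} :
    net.fromNbrs v f i = some a ↔ ∃ u, net.graph.Adj v u ∧ net.ident u = i ∧ f u = a := by
  unfold fromNbrs
  split_ifs with h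
  · rw [Option.some_inj]
    constructor
    · rintro rfl
      exact ⟨_, h.choose_spec.1, h.choose_spec.2, rfl⟩
    · rintro ⟨u, -, hu, rfl⟩
      rw [net.ident_injective (h.choose_spec.2.trans hu.symm)]
  · simp only [false_iff]
    rintro ⟨u, h1, h2, -⟩
    exact h ⟨u, h1, h2⟩

theorem fromNbrs_ident {v u : Fin n} (h : net.graph.Adj v u) (f : Fin n → ℕ) :
    net.fromNbrs v f (net.ident u) = some (f u) :=
  net.fromNbrs_eq_some.2 ⟨u, h, rfl, rfl⟩

end Network

/-- There is an algorithm with messages of at most `B` bits after whose first `τ` rounds each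
processor `v` knows `f net v`. -/
def Known {n k : ℕ} (B τ : ℕ) {X : Type} (f : Network n k → Fin n → X) : Prop :=
  ∃ (A : Algorithm LocalView) (g : A.State → X),
    (∀ net : Network n k, ∀ j < τ, ∀ u v, net.graph.Adj u v →
      Nat.size (A.send (net.config A net.view j u) (net.ident v)) ≤ B) ∧
    ∀ (net : Network n k) (v : Fin n), g (net.config A net.view τ v) = f net v

/-- Encodes extended natural numbers by natural numbers. -/
noncomputable def encodeENat (x : ℕ∞) : ℕ := (x + 1).toNat

/-- Decodes the extended natural numbers. -/
noncomputable def decodeENat (a : ℕ) : ℕ∞ := if a = 0 then ⊤ else (a - 1 : ℕ)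

theorem decodeENat_encodeENat (x : ℕ∞) : decodeENat (encodeENat x) = x := by
  induction x using ENat.recTopCoe with
  | top => simp [encodeENat, decodeENat]
  | coe a =>
    have : encodeENat a = a + 1 := by
      unfold encodeENat
      exact_mod_cast ENat.toNat_natCast (a + 1)
    simp [this, decodeENat]

theorem encodeENat_le {x : ℕ∞} {m : ℕ} (h : ∀ a : ℕ, x = a → a < m) : encodeENat x ≤ m := by
  induction x using ENat.recTopCoe with
  | top => simp [encodeENat]
  | coe a =>
    have : encodeENat a = a + 1 := by
      unfold encodeENat
      exact_mod_cast ENat.toNat_natCast (a + 1)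
    rw [this]
    exact h a rfl

/-- The values after `t` rounds in which every node takes the minimum over its neighbors. -/
noncomputable def floodValue {V : Type} (F : SimpleGraph V) (x : V → ℕ∞) : ℕ → V → ℕ∞
  | 0 => x
  | t + 1 => fun v => floodValue F x t v ⊓ ⨅ u, ⨅ (_ : F.Adj v u), floodValue F x t u

section Flood

variable {V : Type} {F : SimpleGraph V} {x : V → ℕ∞}

theorem floodValue_le {t : ℕ} {u v : V} (p : F.Walk v u) (hp : p.length ≤ t) :
    floodValue F x t v ≤ x u := by
  induction t generalizing v with
  | zero =>
    cases p with
    | nil => exact le_rfl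
    | cons e p => simp at hp
  | succ t ih =>
    cases p with
    | nil => exact inf_le_left.trans (ih Walk.nil (by simp))
    | cons e p => exact inf_le_right.trans ((iInf₂_le _ e).trans (ih p (by simpa using hp)))

theorem exists_floodValue_eq (t : ℕ) (v : V) :
    ∃ u, ∃ p : F.Walk v u, p.length ≤ t ∧ floodValue F x t v = x u := by
  induction t generalizing v with
  | zero => exact ⟨v, Walk.nil, by simp, rfl⟩
  | succ t ih =>
    rcases le_total (floodValue F x t v) (⨅ u, ⨅ (_ : F.Adj v u), floodValue F x t u) with h | h
    · obtain ⟨u, p, hp, hu⟩ := ih v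
      exact ⟨u, p, by omega, (inf_eq_left.2 h).trans hu⟩
    · by_cases htop : (⨅ u, ⨅ (_ : F.Adj v u), floodValue F x t u) = ⊤
      · obtain ⟨u, p, hp, hu⟩ := ih v
        refine ⟨u, p, by omega, ?_⟩
        simp only [floodValue, htop, inf_top_eq, hu]
      · obtain ⟨w, hw, he⟩ := exists_eq_of_iInf_ne_top htop
        obtain ⟨u, p, hp, hu⟩ := ih w
        refine ⟨u, Walk.cons hw p, by simpa using hp, ?_⟩
        exact (inf_eq_right.2 h).trans (he.symm.trans hu)

/-- Flooding along `F` never leaves a cluster, and `t` rounds suffice to reach every node of it. -/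
theorem floodValue_eq_clusterInf {L : Type} {lead : V → L} {t : ℕ}
    (hF : ∀ u v, F.Adj u v → lead u = lead v)
    (ht : ∀ u v, lead u = lead v → ∃ p : F.Walk u v, p.length ≤ t) (v : V) :
    floodValue F x t v = clusterInf lead x v := by
  refine le_antisymm (le_iInf₂ fun u hu => ?_) ?_
  · obtain ⟨p, hp⟩ := ht v u hu.symm
    exact floodValue_le p hp
  · obtain ⟨u, p, -, hu⟩ := exists_floodValue_eq (F := F) (x := x) t v
    rw [hu]
    exact clusterInf_le lead x (p.apply_eq_of_adj hF).symm

end Flood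

namespace Known

variable {n k B τ : ℕ} {X Y : Type} {f : Network n k → Fin n → X}

theorem view : Known B 0 (fun (net : Network n k) v => net.view v) :=
  ⟨⟨LocalView, id, fun _ _ => 0, fun x _ => x, fun _ => ∅⟩, id, by simp, fun _ _ => rfl⟩

theorem map (hf : Known B τ f) (φ : X → Y) : Known B τ (fun net v => φ (f net v)) := by
  obtain ⟨A, g, h1, h2⟩ := hf
  exact ⟨A, φ ∘ g, h1, fun net v => congrArg φ (h2 net v)⟩

theorem congr (hf : Known B τ f) {g : Network n k → Fin n → X} (h : ∀ net v, f net v = g net v) :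
    Known B τ g := by
  obtain rfl : f = g := funext fun net => funext fun v => h net v
  exact hf

/-- One round of communication. -/
theorem exchange (hf : Known B τ f) (m : X → ℕ → ℕ)
    (hm : ∀ (net : Network n k) u v, net.graph.Adj u v →
      Nat.size (m (f net u) (net.ident v)) ≤ B) :
    Known B (τ + 1) (fun net v =>
      (f net v, net.fromNbrs v fun u => m (f net u) (net.ident v))) := by
  obtain ⟨A, g, h1, h2⟩ := hf
  -- The state consists of a round counter, the simulated state, frozen from round `τ` on, and the
  -- messages received last.
  let A' : Algorithm LocalView :=
    { State := ℕ × A.State × (ℕ → Option ℕ)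
      init := fun x => (0, A.init x, fun _ => none)
      send := fun x i => if x.1 < τ then A.send x.2.1 i else m (g x.2.1) i
      receive := fun x r => (x.1 + 1, if x.1 < τ then A.receive x.2.1 r else x.2.1, r)
      output := fun _ => ∅ }
  have hconf : ∀ net : Network n k, ∀ j ≤ τ, ∀ v, (net.config A' net.view j v).1 = j ∧
      (net.config A' net.view j v).2.1 = net.config A net.view j v := by
    intro net j
    induction j with
    | zero => exact fun _ _ => ⟨rfl, rfl⟩
    | succ j ih =>
      intro hj v
      have hlt : j < τ := hj
      have hsend : ∀ u, A'.send (net.config A' net.view j u) (net.ident v) =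
          A.send (net.config A net.view j u) (net.ident v) := by
        intro u
        obtain ⟨h3, h4⟩ := ih (by omega) u
        simp only [A'] at h3 h4 ⊢
        rw [h3, if_pos hlt, h4]
      obtain ⟨h3, h4⟩ := ih (by omega) v
      refine ⟨?_, ?_⟩
      · change (net.config A' net.view j v).1 + 1 = j + 1
        rw [h3]
      · change (if (net.config A' net.view j v).1 < τ then
          A.receive (net.config A' net.view j v).2.1 _ else _) = A.receive _ _
        rw [h3, if_pos hlt, h4]
        congr 1
        exact congrArg (net.fromNbrs v) (funext hsend)
  have hlast : ∀ (net : Network n k) u i,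
      A'.send (net.config A' net.view τ u) i = m (f net u) i := by
    intro net u i
    obtain ⟨h3, h4⟩ := hconf net τ le_rfl u
    change (if (net.config A' net.view τ u).1 < τ then _ else _) = _
    rw [h3, if_neg (lt_irrefl τ), h4, h2]
  refine ⟨A', fun x => (g x.2.1, x.2.2), ?_, ?_⟩
  · intro net j hj u v huv
    rcases Nat.lt_succ_iff_lt_or_eq.1 hj with hlt | rfl
    · obtain ⟨h3, h4⟩ := hconf net j hlt.le u
      have : A'.send (net.config A' net.view j u) (net.ident v) =
          A.send (net.config A net.view j u) (net.ident v) := by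
        simp only [A'] at h3 h4 ⊢
        rw [h3, if_pos hlt, h4]
      rw [this]
      exact h1 net j hlt u v huv
    · rw [hlast]
      exact hm net u v huv
  · intro net v
    obtain ⟨h3, h4⟩ := hconf net τ le_rfl v
    refine Prod.ext ?_ ?_
    · change g (if (net.config A' net.view τ v).1 < τ then _ else _) = _
      rw [h3, if_neg (lt_irrefl τ), h4, h2]
    · change net.fromNbrs v (fun u => A'.send (net.config A' net.view τ u) (net.ident v)) = _
      exact congrArg (net.fromNbrs v) (funext fun u => hlast net u _)

theorem mono (hf : Known B τ f) {τ' : ℕ} (h : τ ≤ τ') : Known B τ' f := by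
  induction τ', h using Nat.le_induction with
  | base => exact hf
  | succ τ' _ ih => exact (ih.exchange (fun _ _ => 0) (by simp)).map Prod.fst

/-- In one round, every processor learns a minimum over its neighbors. -/
theorem nbrInf (hf : Known B τ f) (m : X → ℕ → ℕ)
    (hm : ∀ (net : Network n k) u v, net.graph.Adj u v →
      Nat.size (m (f net u) (net.ident v)) ≤ B) (h : X → ℕ → ℕ → ℕ∞) :
    Known B (τ + 1) (fun net v => (f net v, ⨅ u, ⨅ (_ : net.graph.Adj v u),
      h (f net v) (net.ident u) (m (f net u) (net.ident v)))) := by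
  refine ((hf.exchange m hm).map fun x : X × (ℕ → Option ℕ) =>
    (x.1, ⨅ i, ⨅ a, ⨅ (_ : x.2 i = some a), h x.1 i a)).congr fun net v => ?_
  refine Prod.ext rfl (le_antisymm ?_ ?_)
  · exact le_iInf₂ fun u hu => (iInf_le _ (net.ident u)).trans
      (iInf₂_le (m (f net u) (net.ident v))
        (net.fromNbrs_ident hu fun u => m (f net u) (net.ident v)))
  · refine le_iInf fun i => le_iInf₂ fun a ha => ?_
    obtain ⟨u, hu, rfl, rfl⟩ := (net.fromNbrs_eq_some
      (f := fun u => m (f net u) (net.ident v))).1 ha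
    exact iInf₂_le u hu

/-- In one round, every processor learns a set of neighbors. -/
theorem nbrSet (hf : Known B τ f) (m : X → ℕ → ℕ)
    (hm : ∀ (net : Network n k) u v, net.graph.Adj u v →
      Nat.size (m (f net u) (net.ident v)) ≤ B) (Q : X → ℕ → ℕ → Prop) :
    Known B (τ + 1) (fun net v => (f net v, {i | ∃ u, net.graph.Adj v u ∧ net.ident u = i ∧
      Q (f net v) (net.ident u) (m (f net u) (net.ident v))})) := by
  refine ((hf.exchange m hm).map fun x : X × (ℕ → Option ℕ) =>
    (x.1, {i | ∃ a, x.2 i = some a ∧ Q x.1 i a})).congr fun net v => ?_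
  refine Prod.ext rfl (Set.ext fun i => ⟨?_, ?_⟩)
  · rintro ⟨a, ha, hQ⟩
    obtain ⟨u, hu, rfl, rfl⟩ := (net.fromNbrs_eq_some
      (f := fun u => m (f net u) (net.ident v))).1 ha
    exact ⟨u, hu, rfl, hQ⟩
  · rintro ⟨u, hu, rfl, hQ⟩
    exact ⟨_, net.fromNbrs_ident hu fun u => m (f net u) (net.ident v), hQ⟩

section Flood

variable {F : Network n k → SimpleGraph (Fin n)}

/-- Flooding a subgraph that is known locally. -/
theorem flood (hf : Known B τ f) (hF : ∀ net, F net ≤ net.graph) (nb : X → Set ℕ)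
    (hnb : ∀ net u v, net.graph.Adj v u → (net.ident u ∈ nb (f net v) ↔ (F net).Adj v u))
    (x : X → ℕ∞) (hx : ∀ net v, Nat.size (encodeENat (x (f net v))) ≤ B) (t : ℕ) :
    Known B (τ + t) (fun net v =>
      (f net v, fun j => floodValue (F net) (fun u => x (f net u)) (min j t) v)) := by
  classical
  induction t with
  | zero =>
    refine (hf.map fun y => (y, fun _ : ℕ => x y)).congr fun net v => ?_
    simp [floodValue]
  | succ t ih =>
    have h1 := ih.nbrInf (fun y _ => encodeENat (y.2 t)) (by
      intro net u v _
      obtain ⟨w, -, -, hw⟩ := exists_floodValue_eq (F := F net) (x := fun u => x (f net u)) t u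
      simp only [min_self, hw]
      exact hx net w) (fun y i a => if i ∈ nb y.1 then decodeENat a else ⊤)
    refine (h1.map fun y => (y.1.1, fun j => if j ≤ t then y.1.2 j else y.1.2 t ⊓ y.2)).congr
      fun net v => Prod.ext rfl (funext fun j => ?_)
    dsimp only
    split_ifs with hj
    · rw [min_eq_left hj, min_eq_left (by omega)]
    · rw [min_eq_right (by omega : t + 1 ≤ j), min_self, floodValue]
      congr 1
      refine iInf_congr fun u => ?_
      by_cases hu : net.graph.Adj v u
      · simp [hu, hnb net u v hu, decodeENat_encodeENat, iInf_eq_if]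
      · have : ¬ (F net).Adj v u := fun h => hu (hF net h)
        simp [hu, this]

/-- Every processor learns a minimum over its cluster. -/
theorem learnClusterInf {L : Type} {lead : Network n k → Fin n → L} (hf : Known B τ f)
    (hF : ∀ net, F net ≤ net.graph) (nb : X → Set ℕ)
    (hnb : ∀ net u v, net.graph.Adj v u → (net.ident u ∈ nb (f net v) ↔ (F net).Adj v u))
    (x : X → ℕ∞) (hx : ∀ net v, Nat.size (encodeENat (x (f net v))) ≤ B) (t : ℕ)
    (hlead : ∀ net u v, (F net).Adj u v → lead net u = lead net v)
    (ht : ∀ net u v, lead net u = lead net v → ∃ p : (F net).Walk u v, p.length ≤ t) :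
    Known B (τ + t) (fun net v =>
      (f net v, clusterInf (lead net) (fun u => x (f net u)) v)) := by
  refine ((hf.flood hF nb hnb x hx t).map fun y => (y.1, y.2 t)).congr fun net v => ?_
  simp only [min_self, floodValue_eq_clusterInf (hlead net) (ht net)]

end Flood

/-- Running an algorithm on inputs that the processors have found out. -/
theorem run (hf : Known B τ f) {I : Type} (A : Algorithm I) (ι : X → I) (T : ℕ)
    (hA : ∀ (net : Network n k), ∀ j < T, ∀ u v, net.graph.Adj u v →
      Nat.size (A.send (net.config A (fun w => ι (f net w)) j u) (net.ident v)) ≤ B) :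
    Known B (τ + T) (fun net v => (f net v, net.config A (fun w => ι (f net w)) T v)) := by
  induction T with
  | zero => exact hf.map fun y => (y, A.init (ι y))
  | succ T ih =>
    have h1 := (ih fun net j hj => hA net j (by omega)).exchange (fun y i => A.send y.2 i)
      fun net u v huv => hA net T (by omega) u v huv
    exact h1.map fun y => (y.1.1, A.receive y.1.2 y.2)

end Known

/-- Algorithms for all sizes of networks can be combined, as the processors know the size. -/
theorem exists_algorithm_of_known {k b : ℕ} (τ : ℕ → ℕ)
    (E : ∀ n, Network n k → Fin n → Set ℕ) (hE : ∀ n, Known (b * Nat.size n) (τ n) (E n)) :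
    ∃ A : Algorithm LocalView, ∀ n (net : Network n k) (F : SimpleGraph (Fin n)),
      (∀ u v, net.graph.Adj u v → (net.ident v ∈ E n net u ↔ F.Adj u v)) →
        net.Computes A net.view b (τ n) F := by
  choose A g h1 h2 using hE
  let A' : Algorithm LocalView :=
    { State := Σ n, (A n).State
      init := fun x => ⟨x.size, (A x.size).init x⟩
      send := fun x i => (A x.1).send x.2 i
      receive := fun x r => ⟨x.1, (A x.1).receive x.2 r⟩
      output := fun x => g x.1 x.2 }
  have hconf : ∀ n (net : Network n k) j v,
      net.config A' net.view j v = ⟨n, net.config (A n) net.view j v⟩ := by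
    intro n net j
    induction j with
    | zero => exact fun _ => rfl
    | succ j ih =>
      intro v
      simp only [Network.config, ih]
      rfl
  refine ⟨A', fun n net F hF => ⟨?_, ?_⟩⟩
  · intro j hj u v huv
    rw [hconf]
    exact h1 n net j hj u v huv
  · intro u v huv
    rw [hconf, ← hF u v huv, ← h2 n net u]

/-! ### Distributed computation of the clusters -/

/-- An injective numbering of the edges that is compatible with the weights. -/
def keyOf (Q w a b : ℕ) : ℕ := w * Q ^ 2 + (max a b * Q + min a b)

/-- The identifiers contribute less than `Q ^ 2`, so keys are ordered by weight first, and the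
weight can be recovered from the key. -/
theorem keyOf_div {Q w a b : ℕ} (ha : a < Q) (hb : b < Q) : keyOf Q w a b / Q ^ 2 = w := by
  have h1 : max a b + 1 ≤ Q := by omega
  have h2 : max a b * Q + min a b < Q ^ 2 := by
    have := Nat.mul_le_mul_right Q h1
    rw [pow_two]
    have : min a b < Q := by omega
    nlinarith
  have hQ : 0 < Q ^ 2 := Nat.pow_pos (by omega)
  rw [keyOf, Nat.mul_comm, Nat.mul_add_div hQ, Nat.div_eq_of_lt h2, add_zero]

theorem keyOf_lt {Q w a b : ℕ} (ha : a < Q) (hb : b < Q) (hw : w ≤ Q) (hQ : 2 ≤ Q) :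
    keyOf Q w a b < Q ^ 4 := by
  have h1 : keyOf Q w a b < (w + 1) * Q ^ 2 := by
    have := Nat.lt_succ_iff.2 (keyOf_div (w := w) ha hb).le
    exact (Nat.div_lt_iff_lt_mul (by positivity)).1 this
  calc keyOf Q w a b < (w + 1) * Q ^ 2 := h1
    _ ≤ (Q * Q) * Q ^ 2 := Nat.mul_le_mul_right _ (by nlinarith)
    _ = Q ^ 4 := by ring

theorem keyOf_inj {Q w w' a b a' b' : ℕ} (ha : a < Q) (hb : b < Q) (ha' : a' < Q) (hb' : b' < Q)
    (h : keyOf Q w a b = keyOf Q w' a' b') : max a b = max a' b' ∧ min a b = min a' b' := by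
  have hw : w = w' := by rw [← keyOf_div (w := w) ha hb, h, keyOf_div ha' hb']
  subst hw
  have h1 : max a b * Q + min a b = max a' b' * Q + min a' b' := by
    unfold keyOf at h; omega
  have hm : min a b < Q := by omega
  have hm' : min a' b' < Q := by omega
  have h2 : max a b = max a' b' := by
    have e1 : (max a b * Q + min a b) / Q = max a b := by
      rw [mul_comm, Nat.mul_add_div (by omega), Nat.div_eq_of_lt hm, add_zero]
    have e2 : (max a' b' * Q + min a' b') / Q = max a' b' := by
      rw [mul_comm, Nat.mul_add_div (by omega), Nat.div_eq_of_lt hm', add_zero]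
    rw [← e1, h1, e2]
  rw [h2] at h1
  exact ⟨h2, by omega⟩

namespace Network

variable {n k : ℕ} (net : Network n k)

/-- The numbering of the edges of a network. -/
def key : Sym2 (Fin n) → ℕ :=
  Sym2.lift ⟨fun u v => keyOf (n ^ k) (net.weight s(u, v)) (net.ident u) (net.ident v),
    fun u v => by simp only [keyOf, Sym2.eq_swap, max_comm, min_comm]⟩

theorem key_mk (u v : Fin n) :
    net.key s(u, v) = keyOf (n ^ k) (net.weight s(u, v)) (net.ident u) (net.ident v) := rfl

theorem key_injective : Function.Injective net.key := by
  intro e f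
  induction e with | _ u v =>
  induction f with | _ u' v' =>
  intro h
  obtain ⟨h1, h2⟩ := keyOf_inj (net.ident_lt u) (net.ident_lt v) (net.ident_lt u')
    (net.ident_lt v') h
  have : (net.ident u = net.ident u' ∧ net.ident v = net.ident v') ∨
    (net.ident u = net.ident v' ∧ net.ident v = net.ident u') := by omega
  rcases this with ⟨h3, h4⟩ | ⟨h3, h4⟩
  · rw [net.ident_injective h3, net.ident_injective h4]
  · rw [net.ident_injective h3, net.ident_injective h4, Sym2.eq_swap]

theorem weight_le_of_key_le (e f : Sym2 (Fin n)) (h : net.key e ≤ net.key f) :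
    net.weight e ≤ net.weight f := by
  induction e with | _ u v =>
  induction f with | _ u' v' =>
  have := Nat.div_le_div_right (c := (n ^ k) ^ 2) h
  rwa [key_mk, key_mk, keyOf_div (net.ident_lt u) (net.ident_lt v),
    keyOf_div (net.ident_lt u') (net.ident_lt v')] at this

theorem key_lt (hQ : 2 ≤ n ^ k) {u v : Fin n} (h : net.graph.Adj u v) :
    net.key s(u, v) < (n ^ k) ^ 4 :=
  keyOf_lt (net.ident_lt u) (net.ident_lt v) (net.weight_le _ h) hQ

/-- The identifiers of the neighbors of `v` in the subgraph `F`. -/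
def treeNbrs (F : SimpleGraph (Fin n)) (v : Fin n) : Set ℕ := {i | ∃ u, F.Adj v u ∧ net.ident u = i}

theorem ident_mem_treeNbrs {F : SimpleGraph (Fin n)} {u v : Fin n} :
    net.ident u ∈ net.treeNbrs F v ↔ F.Adj v u :=
  ⟨fun ⟨_, hw, he⟩ => net.ident_injective he ▸ hw, fun h => ⟨u, h, rfl⟩⟩

/-- What the processor `v` knows about the clusters: besides its view of the network, the
identifiers of the root of its cluster and of its neighbors in the tree. -/
noncomputable def clusterState (F : SimpleGraph (Fin n)) (lead : Fin n → Fin n) (v : Fin n) :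
    LocalView × ℕ × Set ℕ :=
  (net.view v, net.ident (lead v), net.treeNbrs F v)

end Network

/-- The number of the edge to the neighbor with identifier `i`. -/
def LocalView.edgeKey (Q : ℕ) (x : LocalView) (i : ℕ) : ℕ :=
  keyOf Q ((x.nbr i).getD 0) x.ident i

theorem Network.edgeKey_view {n k : ℕ} (net : Network n k) {u v : Fin n} (h : net.graph.Adj v u) :
    (net.view v).edgeKey (n ^ k) (net.ident u) = net.key s(v, u) := by
  have : (net.view v).nbr (net.ident u) = some (net.weight s(v, u)) :=
    net.fromNbrs_ident h fun u => net.weight s(v, u)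
  rw [LocalView.edgeKey, this]
  rfl

/-- All numbers up to `(n ^ k) ^ 4` fit into the messages, and there are enough identifiers. -/
structure MessagesFit (n k B : ℕ) : Prop where
  size_le : ∀ m ≤ (n ^ k) ^ 4, Nat.size m ≤ B
  two_le : 2 ≤ n ^ k
  le_pow : n ≤ n ^ k

theorem messagesFit {n k B : ℕ} (hn : 2 ≤ n) (hk : k ≠ 0) (hB : 4 * k * Nat.size n ≤ B) :
    MessagesFit n k B := by
  have hnk : n ≤ n ^ k := Nat.le_self_pow hk n
  refine ⟨fun m hm => Nat.size_le.2 (hm.trans_lt ?_), hn.trans hnk, hnk⟩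
  calc (n ^ k) ^ 4 = n ^ (4 * k) := by rw [← pow_mul, mul_comm]
    _ < (2 ^ Nat.size n) ^ (4 * k) := Nat.pow_lt_pow_left (Nat.lt_size_self n) (by omega)
    _ = 2 ^ (4 * k * Nat.size n) := by rw [← pow_mul, mul_comm]
    _ ≤ 2 ^ B := Nat.pow_le_pow_right (by norm_num) hB

namespace MessagesFit

variable {n k B : ℕ} (hB : MessagesFit n k B)

include hB

theorem pow_four : (n ^ k) * 8 ≤ (n ^ k) ^ 4 := by
  have h2 := hB.two_le
  have : 2 ^ 3 ≤ (n ^ k) ^ 3 := Nat.pow_le_pow_left h2 3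
  calc (n ^ k) * 8 ≤ (n ^ k) * (n ^ k) ^ 3 := Nat.mul_le_mul_left _ this
    _ = (n ^ k) ^ 4 := by ring

theorem size_encode {x : ℕ∞} (hx : ∀ a : ℕ, x = a → a < (n ^ k) ^ 4) :
    Nat.size (encodeENat x) ≤ B :=
  hB.size_le _ (encodeENat_le hx)

theorem size_ident (net : Network n k) (v : Fin n) : Nat.size (net.ident v) ≤ B := by
  have h1 := hB.pow_four
  have h2 := net.ident_lt v
  exact hB.size_le _ (by omega)

end MessagesFit

theorem lt_of_iInf_eq_coe {ι : Type*} {p : ι → Prop} {f : ι → ℕ∞} {m : ℕ}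
    (h : ∀ i, p i → ∀ a : ℕ, f i = a → a < m) (a : ℕ) (ha : ⨅ i, ⨅ (_ : p i), f i = a) : a < m := by
  obtain ⟨i, hi, he⟩ := exists_eq_of_iInf_eq_coe ha
  exact h i hi a he

section Phase

variable {n k B τ : ℕ} {F : Network n k → SimpleGraph (Fin n)}
  {lead : Network n k → Fin n → Fin n} {R S : ℕ}

theorem Known.learnClusterInf_state {Y : Type} {g : Network n k → Fin n → Y}
    (hf : Known B τ fun net v => (net.clusterState (F net) (lead net) v, g net v))
    (hI : ∀ net, IsFragments net.graph net.key (F net) (lead net) R S)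
    (x : (LocalView × ℕ × Set ℕ) × Y → ℕ∞)
    (hx : ∀ net v,
      Nat.size (encodeENat (x (net.clusterState (F net) (lead net) v, g net v))) ≤ B)
    {t : ℕ} (ht : 2 * R ≤ t) :
    Known B (τ + t) (fun net v => ((net.clusterState (F net) (lead net) v, g net v),
      clusterInf (lead net) (fun u => x (net.clusterState (F net) (lead net) u, g net u)) v)) := by
  refine hf.learnClusterInf (fun net => (hI net).le) (fun y => y.1.2.2) ?_ x hx t
    (fun net => (hI net).lead_eq) ?_
  · exact fun net u v _ => net.ident_mem_treeNbrs
  · intro net u v huv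
    obtain ⟨p, hp⟩ := (hI net).exists_walk huv
    exact ⟨p, hp.trans ht⟩

variable (hB : MessagesFit n k B)
  (hI : ∀ net, IsFragments net.graph net.key (F net) (lead net) R S)
  {t : ℕ} (ht : 2 * R ≤ t)

include hB in
theorem outKey_lt (net : Network n k) (v : Fin n) (a : ℕ)
    (ha : outKey net.graph net.key (lead net) v = a) : a < (n ^ k) ^ 4 := by
  refine lt_of_iInf_eq_coe (fun u hu a ha => ?_) a ha
  have : net.key s(v, u) = a := by exact_mod_cast ha
  exact this ▸ net.key_lt hB.two_le hu.1

open Classical in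
include hB in
/-- The processors find out the lightest edges between their own and other clusters. -/
theorem Known.learnOutKey (hf : Known B τ fun net v => net.clusterState (F net) (lead net) v) :
    Known B (τ + 1) (fun net v => (net.clusterState (F net) (lead net) v,
      outKey net.graph net.key (lead net) v)) := by
  refine (hf.nbrInf (fun x _ => x.2.1) (fun net u v _ => hB.size_ident net _) fun x i a =>
    if a ≠ x.2.1 then (x.1.edgeKey (n ^ k) i : ℕ∞) else ⊤).congr fun net v => ?_
  refine Prod.ext rfl (iInf_congr fun u => ?_)
  by_cases hu : net.graph.Adj v u
  · by_cases hl : lead net u = lead net v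
    · simp [hl, Network.clusterState]
    · have : net.ident (lead net u) ≠ net.ident (lead net v) := net.ident_injective.ne hl
      simp [hu, hl, this, Network.clusterState, net.edgeKey_view hu]
  · simp [hu]

include hB hI ht in
/-- The processors find out the lightest edge that leaves their cluster. -/
theorem Known.learnClusterOutKey
    (hf : Known B τ fun net v => net.clusterState (F net) (lead net) v) :
    Known B (τ + 1 + t) (fun net v => (net.clusterState (F net) (lead net) v,
      clusterInf (lead net) (outKey net.graph net.key (lead net)) v)) := by
  refine (((hf.learnOutKey hB).learnClusterInf_state hI (fun x => x.2) ?_ ht).map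
    fun x => (x.1.1, x.2)).congr fun net v => rfl
  exact fun net v => hB.size_encode (outKey_lt hB net v)

open Classical in
include hB hI in
/-- The processors find out how far away the root of their cluster is. -/
theorem Known.learnRootDist {Y : Type} {g : Network n k → Fin n → Y}
    (hf : Known B τ fun net v => (net.clusterState (F net) (lead net) v, g net v)) :
    Known B (τ + t) (fun net v => ((net.clusterState (F net) (lead net) v, g net v),
      fun j => ∃ p : (F net).Walk v (lead net v), p.length ≤ min j t)) := by
  -- Only roots start with `0`, so `0` has arrived after `j` rounds exactly if the root is at most
  -- `j` hops away.
  have h1 := hf.flood (fun net => (hI net).le) (fun y => y.1.2.2)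
    (fun net u v _ => net.ident_mem_treeNbrs)
    (fun y => if y.1.1.ident = y.1.2.1 then 0 else ⊤) (fun net v => ?_) t
  · refine (h1.map fun y => (y.1, fun j => y.2 j = 0)).congr fun net v =>
      Prod.ext rfl (funext fun j => propext ⟨fun h => ?_, ?_⟩)
    · obtain ⟨u, p, hp, hu⟩ := exists_floodValue_eq (F := F net)
        (x := fun u => if (net.clusterState (F net) (lead net) u).1.ident =
          (net.clusterState (F net) (lead net) u).2.1 then 0 else ⊤) (min j t) v
      rw [show floodValue (F net) _ (min j t) v = 0 from h] at hu
      split_ifs at hu with he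
      · have he' : u = lead net u := net.ident_injective he
        have : lead net v = u := (p.apply_eq_of_adj (hI net).lead_eq).trans he'.symm
        rw [this]
        exact ⟨p, hp⟩
      · exact absurd hu.symm ENat.top_ne_zero
    · rintro ⟨p, hp⟩
      refine le_antisymm ((floodValue_le p hp).trans ?_) zero_le
      dsimp only
      rw [if_pos]
      exact congrArg net.ident ((hI net).lead_lead v).symm
  · refine hB.size_encode fun a ha => ?_
    split_ifs at ha
    · have : 0 = a := by exact_mod_cast ha
      have := hB.two_le
      subst a; positivity
    · exact absurd ha (ENat.top_ne_natCast a)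

open Classical in
include hB hI ht in
/-- The processors find out the edge by means of which their cluster points to another one. -/
theorem Known.learnTargetKey {D : ℕ} (hD : D ≤ t)
    (hf : Known B τ fun net v => net.clusterState (F net) (lead net) v) :
    Known B (τ + 1 + t + t + t) (fun net v => (net.clusterState (F net) (lead net) v,
      targetKey net.graph net.key (F net) (lead net) D v)) := by
  have h1 := ((hf.learnClusterOutKey hB hI ht).learnRootDist hB hI (t := t)).map
    fun y => (y.1.1, y.1.2, y.2 D)
  -- A cluster is active if all its nodes are close to the root; this conjunction is the minimum of
  -- the indicator values.
  have h2 := h1.learnClusterInf_state hI (fun y => if y.2.2 then 1 else 0) (fun net v => ?_) ht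
  · refine (h2.map fun y => (y.1.1, if y.2 ≠ 0 then y.1.2.1 else ⊤)).congr fun net v =>
      Prod.ext rfl ?_
    have hact : IsActive (F net) (lead net) D v ↔ clusterInf (lead net) (fun u =>
        if ∃ p : (F net).Walk u (lead net u), p.length ≤ min D t then (1 : ℕ∞) else 0) v ≠ 0 := by
      rw [min_eq_left hD]
      constructor
      · intro ha h0
        obtain ⟨u, hu, he⟩ := exists_of_clusterInf_ne_top (h0.trans_ne ENat.zero_ne_top)
        rw [h0, if_pos (ha u hu)] at he
        exact one_ne_zero he
      · intro hne u hu
        by_contra hcon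
        refine hne (le_antisymm ((clusterInf_le _ _ hu).trans ?_) zero_le)
        rw [if_neg hcon]
    dsimp only
    rw [targetKey]
    exact if_congr hact.symm rfl rfl
  · refine hB.size_encode fun a ha => ?_
    have h2 := hB.two_le
    have h3 := hB.pow_four
    have : a ≤ 1 := by
      dsimp only at ha
      split_ifs at ha
      · exact (by exact_mod_cast ha : 1 = a).ge
      · exact (by exact_mod_cast ha : 0 = a).symm.le.trans zero_le_one
    omega

variable {D : ℕ}

/-- Whether the processor is the endpoint of the edge by means of which its cluster points to the
cluster of the neighbor with identifier `i`. -/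
def pointsTo (Q : ℕ) (x : LocalView) (y : ℕ∞) (i : ℕ) : Prop := (x.edgeKey Q i : ℕ∞) = y

theorem pointsTo_iff (net : Network n k) {u v : Fin n} (h : net.graph.Adj v u) :
    pointsTo (n ^ k) (net.view v) (targetKey net.graph net.key (F net) (lead net) D v)
      (net.ident u) ↔ Points net.graph net.key (F net) (lead net) D v u := by
  rw [pointsTo, net.edgeKey_view h, Points, and_iff_right h]

open Classical in
include hB hI ht in
-- The endpoint of the pointer recognizes it by its key, reads the color on the other side and
-- floods it through its cluster.
theorem Known.learnNextInf {c : Network n k → Fin n → ℕ} (hc : ∀ net v, c net v < (n ^ k) ^ 4)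
    (hf : Known B τ fun net v => (net.clusterState (F net) (lead net) v,
      targetKey net.graph net.key (F net) (lead net) D v, c net v)) :
    Known B (τ + 1 + t) (fun net v => (net.clusterState (F net) (lead net) v,
      targetKey net.graph net.key (F net) (lead net) D v, c net v,
      nextInf (lead net) (Points net.graph net.key (F net) (lead net) D) (c net) v)) := by
  have h1 := hf.nbrInf (fun x _ => x.2.2) (fun net u v _ => hB.size_le _ (hc net u).le) fun x i a =>
    if pointsTo (n ^ k) x.1.1 x.2.1 i then (a : ℕ∞) else ⊤
  have h2 := (h1.congr (g := fun net v => ((net.clusterState (F net) (lead net) v,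
      targetKey net.graph net.key (F net) (lead net) D v, c net v),
      ⨅ u, ⨅ (_ : Points net.graph net.key (F net) (lead net) D v u), (c net u : ℕ∞)))
    fun net v => Prod.ext rfl (iInf_congr fun u => ?_)).map fun x => (x.1.1, x.1.2.1, x.1.2.2, x.2)
  · refine ((h2.learnClusterInf_state hI (fun x => x.2.2.2) (fun net v => ?_) ht).map
      fun x => (x.1.1, x.1.2.1, x.1.2.2.1, x.2)).congr fun net v => rfl
    refine hB.size_encode (lt_of_iInf_eq_coe fun u hu a ha => ?_)
    have : c net u = a := by exact_mod_cast ha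
    exact this ▸ hc net u
  · by_cases hu : net.graph.Adj v u
    · have := pointsTo_iff (F := F) (lead := lead) (D := D) net hu
      simp only [Network.clusterState, this, hu, iInf_true]
      rw [iInf_eq_if]
    · have : ¬ Points net.graph net.key (F net) (lead net) D v u := fun h => hu h.1
      simp [hu, this]

open Classical in
include hB hI ht in
theorem Known.learnPrevInf {Y : Type} {g : Network n k → Fin n → Y} {c : Network n k → Fin n → ℕ}
    (hc : ∀ net v, c net v < (n ^ k) ^ 4)
    (hf : Known B τ fun net v => (net.clusterState (F net) (lead net) v,
      targetKey net.graph net.key (F net) (lead net) D v, c net v, g net v)) :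
    Known B (τ + 1 + t) (fun net v => (net.clusterState (F net) (lead net) v,
      targetKey net.graph net.key (F net) (lead net) D v, c net v, g net v,
      prevInf (lead net) (Points net.graph net.key (F net) (lead net) D) (c net) v)) := by
  have hsize : ∀ net v, Nat.size (encodeENat (c net v : ℕ∞)) ≤ B := by
    intro net v
    refine hB.size_encode fun a ha => ?_
    have : c net v = a := by exact_mod_cast ha
    exact this ▸ hc net v
  -- The receiver cannot tell which of its edges are pointers to it. The sender therefore transmits
  -- its color only along its pointer and otherwise `0`, the code of `⊤`.
  have h1 := hf.nbrInf (fun x i => if pointsTo (n ^ k) x.1.1 x.2.1 i then encodeENat x.2.2.1 else 0)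
    (fun net u v _ => by
      dsimp only
      split_ifs
      · exact hsize net u
      · simp) fun x i a => decodeENat a
  have h2 := (h1.congr (g := fun net v => ((net.clusterState (F net) (lead net) v,
      targetKey net.graph net.key (F net) (lead net) D v, c net v, g net v),
      ⨅ u, ⨅ (_ : Points net.graph net.key (F net) (lead net) D u v), (c net u : ℕ∞)))
    fun net v => Prod.ext rfl (iInf_congr fun u => ?_)).map
      fun x => (x.1.1, x.1.2.1, x.1.2.2.1, x.1.2.2.2, x.2)
  · refine ((h2.learnClusterInf_state hI (fun x => x.2.2.2.2) (fun net v => ?_) ht).map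
      fun x => (x.1.1, x.1.2.1, x.1.2.2.1, x.1.2.2.2.1, x.2)).congr fun net v => rfl
    refine hB.size_encode (lt_of_iInf_eq_coe fun u hu a ha => ?_)
    have : c net u = a := by exact_mod_cast ha
    exact this ▸ hc net u
  · by_cases hu : net.graph.Adj v u
    · have := pointsTo_iff (F := F) (lead := lead) (D := D) net hu.symm
      simp only [Network.clusterState, this, hu, iInf_true]
      by_cases hp : Points net.graph net.key (F net) (lead net) D u v
      · simp [hp, decodeENat_encodeENat]
      · simp [hp, decodeENat]
    · have : ¬ Points net.graph net.key (F net) (lead net) D u v := fun h => hu h.1.symm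
      simp [hu, this]

end Phase

section Phase

variable {n k B τ : ℕ} {F : Network n k → SimpleGraph (Fin n)}
  {lead : Network n k → Fin n → Fin n} {R S D q : ℕ}

/-- The right-hand side is known to every node of the cluster, also to those far from the endpoint
of the pointer. -/
theorem keeps_iff {net : Network n k} {c : Fin n → ℕ}
    (hc : ∀ u v, lead net u = lead net v → c u = c v) (v : Fin n) :
    Keeps (lead net) (Points net.graph net.key (F net) (lead net) D) c v ↔
      targetKey net.graph net.key (F net) (lead net) D v ≠ ⊤ ∧
        ¬ IsPeak (lead net) (Points net.graph net.key (F net) (lead net) D) c v := by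
  constructor
  · rintro ⟨x, y, hx, hP, hk⟩
    rw [← targetKey_congr hx, ← hP.2]
    exact ⟨ENat.natCast_ne_top _, (IsPeak.congr hc hx).not.1 hk⟩
  · rintro ⟨h1, h2⟩
    obtain ⟨x, y, hx, hP⟩ := exists_points h1
    exact ⟨x, y, hx, hP, (IsPeak.congr hc hx).not.2 h2⟩

variable (hB : MessagesFit n k B)
  (hI : ∀ net, IsFragments net.graph net.key (F net) (lead net) R S) {t : ℕ}

include hB hI in
/-- The processors reduce the number of colors of the clusters. -/
theorem Known.learnCvColor (ht : 2 * R ≤ t)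
    (hf : Known B τ fun net v => (net.clusterState (F net) (lead net) v,
      targetKey net.graph net.key (F net) (lead net) D v)) (j : ℕ) :
    Known B (τ + j * (1 + t)) (fun net v => (net.clusterState (F net) (lead net) v,
      targetKey net.graph net.key (F net) (lead net) D v,
      cvColor (lead net) (Points net.graph net.key (F net) (lead net) D)
        (fun u => net.ident (lead net u)) j v)) := by
  induction j with
  | zero =>
    rw [zero_mul, add_zero]
    exact hf.map fun x => (x.1, x.2, x.1.2.1)
  | succ j ih =>
    have h1 := ih.learnNextInf hB hI ht fun net v => by
      have h2 := hB.two_le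
      have h3 := hB.pow_four
      have h4 := cvColor_lt (lead := lead net) (P := Points net.graph net.key (F net) (lead net) D)
        h2 (fun u => net.ident_lt (lead net u)) j v
      have h5 := paletteSize_le (p := n ^ k) (b := (n ^ k) * 8) (by omega) (by omega) j
      omega
    rw [show τ + (j + 1) * (1 + t) = τ + j * (1 + t) + 1 + t by ring]
    exact h1.map fun x => (x.1, x.2.1, cvStep x.2.2.1 x.2.2.2)

/-- Within a merged cluster all chains end in the same old cluster, the only one without a kept
pointer. Hence the minimum is taken over a single identifier. -/
theorem clusterInf_unique_root {net : Network n k} {c : Fin n → ℕ}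
    (h : IsFragments net.graph net.key (F net) (lead net) R S)
    (hc : ∀ u v, lead net u = lead net v → c u = c v) (hq : ∀ v, c v < q)
    (hproper : ∀ x y, Points net.graph net.key (F net) (lead net) D x y → c x ≠ c y)
    {x : Fin n → ℕ∞}
    (hx : ∀ v, Keeps (lead net) (Points net.graph net.key (F net) (lead net) D) c v → x v = ⊤)
    (hx' : ∀ v, ¬ Keeps (lead net) (Points net.graph net.key (F net) (lead net) D) c v →
      x v = net.ident (lead net v)) (v : Fin n) :
    clusterInf (mergeLead (lead net) (Points net.graph net.key (F net) (lead net) D) c q) x v =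
      net.ident (mergeLead (lead net) (Points net.graph net.key (F net) (lead net) D) c q v) := by
  have hP := isPointing_points (F := F net) (lead := lead net) (D := D)
    (net.key_injective.injOn (s := net.graph.edgeSet))
  have hl := lead_mergeLead hP h.lead_lead hc hq hproper v
  have hk := not_keeps_mergeLead hP h.lead_lead hc hq hproper v
  refine le_antisymm ?_ (le_iInf₂ fun u hu => ?_)
  · refine (clusterInf_le _ _ ?_).trans ((hx' _ hk).trans (by rw [hl])).le
    rw [mergeLead_of_not_keeps hP h.lead_lead hk, hl]
  · by_cases hku : Keeps (lead net) (Points net.graph net.key (F net) (lead net) D) c u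
    · rw [hx u hku]; exact le_top
    · rw [hx' u hku, ← hu, mergeLead_of_not_keeps hP h.lead_lead hku]

open Classical in
include hB hI in
/-- The processors merge the clusters along the kept pointers. -/
theorem Known.learnMerge {c : Network n k → Fin n → ℕ} (hSD : 2 * S ≤ D)
    (hc : ∀ net u v, lead net u = lead net v → c net u = c net v) (hq : ∀ net v, c net v < q)
    (hproper : ∀ net x y, Points net.graph net.key (F net) (lead net) D x y → c net x ≠ c net y)
    (ht : 2 * ((2 * q + 1) * (2 * D + 1) + R) ≤ t)
    (hf : Known B τ fun net v => (net.clusterState (F net) (lead net) v,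
      targetKey net.graph net.key (F net) (lead net) D v,
      IsPeak (lead net) (Points net.graph net.key (F net) (lead net) D) (c net) v)) :
    Known B (τ + 1 + t) (fun net v => net.clusterState
      (mergeGraph (F net) (lead net) (Points net.graph net.key (F net) (lead net) D) (c net))
      (mergeLead (lead net) (Points net.graph net.key (F net) (lead net) D) (c net) q) v) := by
  have hI' := fun net => (hI net).merge (D := D) (c := c net)
    (net.key_injective.injOn (s := net.graph.edgeSet)) hSD (hc net) (hq net) (hproper net)
  -- One bit per edge tells the other endpoint whether a kept pointer uses this edge; afterwards
  -- both ends know the new tree edges.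
  have h1 := hf.nbrSet
    (fun x i => if pointsTo (n ^ k) x.1.1 x.2.1 i ∧ ¬ x.2.2 then 1 else 0)
    (fun net u v _ => hB.size_le _ (by
      have h2 := hB.two_le
      have h3 := hB.pow_four
      dsimp only
      split_ifs <;> omega))
    fun x i a => i ∈ x.1.2.2 ∨ (pointsTo (n ^ k) x.1.1 x.2.1 i ∧ ¬ x.2.2) ∨ a = 1
  have h2 := h1.congr (g := fun net v => ((net.clusterState (F net) (lead net) v,
      targetKey net.graph net.key (F net) (lead net) D v,
      IsPeak (lead net) (Points net.graph net.key (F net) (lead net) D) (c net) v),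
      net.treeNbrs (mergeGraph (F net) (lead net)
        (Points net.graph net.key (F net) (lead net) D) (c net)) v)) fun net v => by
    refine Prod.ext rfl (Set.ext fun i => exists_congr fun u => ?_)
    by_cases hu : net.graph.Adj v u
    · have e1 := pointsTo_iff (F := F) (lead := lead) (D := D) net hu
      have e2 := pointsTo_iff (F := F) (lead := lead) (D := D) net hu.symm
      have e3 : net.ident u ∈ (net.clusterState (F net) (lead net) v).2.2 ↔ (F net).Adj v u :=
        net.ident_mem_treeNbrs
      have e4 : (net.clusterState (F net) (lead net) v).1 = net.view v := rfl
      have e5 : (net.clusterState (F net) (lead net) u).1 = net.view u := rfl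
      dsimp only
      rw [e3, e4, e5, e1, e2, mergeGraph, sup_adj, fromRel_adj]
      simp only [hu, hu.ne, true_and, ne_eq, not_false_eq_true, KeepEdge]
      rw [and_comm]
      refine and_congr_left fun _ => or_congr_right (or_congr_right ?_)
      split_ifs with h <;> simp [h]
    · have : ¬ (mergeGraph (F net) (lead net)
        (Points net.graph net.key (F net) (lead net) D) (c net)).Adj v u :=
        fun h => hu ((hI' net).le h)
      simp [hu, this]
  have h3 := h2.learnClusterInf (fun net => (hI' net).le) (fun y => y.2)
    (fun net u v _ => net.ident_mem_treeNbrs)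
    (fun y => if y.1.2.1 ≠ ⊤ ∧ ¬ y.1.2.2 then ⊤ else (y.1.1.2.1 : ℕ∞)) (fun net v => ?_) t
    (fun net => (hI' net).lead_eq) (fun net u v huv => ?_)
  · refine (h3.map fun y => (y.1.1.1.1, y.2.toNat, y.1.2)).congr fun net v => ?_
    refine Prod.ext rfl (Prod.ext ?_ rfl)
    dsimp only
    rw [clusterInf_unique_root (hI net) (hc net) (hq net) (hproper net), ENat.toNat_natCast]
    · rfl
    · intro v hv
      rw [if_pos ((keeps_iff (hc net) v).1 hv)]
    · intro v hv
      rw [if_neg ((keeps_iff (hc net) v).not.1 hv)]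
      rfl
  · refine hB.size_encode fun a ha => ?_
    dsimp only at ha
    split_ifs at ha
    · exact absurd ha (ENat.top_ne_natCast a)
    · have h4 : net.ident (lead net v) = a := by exact_mod_cast ha
      have h5 := net.ident_lt (lead net v)
      have h6 := hB.pow_four
      omega
  · obtain ⟨p, hp⟩ := (hI' net).exists_walk huv
    exact ⟨p, hp.trans ht⟩

include hB hI in
/-- One phase of the computation of the clusters. -/
theorem Known.exists_merge (hn : 2 ≤ n) (hSD : 2 * S ≤ D) (hq : q = 2 ^ (k + 4))
    (ht : 2 * ((2 * q + 1) * (2 * D + 1) + R) ≤ t)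
    (hf : Known B τ fun net v => net.clusterState (F net) (lead net) v) :
    ∃ (F' : Network n k → SimpleGraph (Fin n)) (lead' : Network n k → Fin n → Fin n),
      (∀ net, IsFragments net.graph net.key (F' net) (lead' net)
        ((2 * q + 1) * (2 * D + 1) + R) (2 * S)) ∧
      Known B (τ + (logStar n + 6) * (1 + t))
        (fun net v => net.clusterState (F' net) (lead' net) v) := by
  have hDR : D ≤ (2 * q + 1) * (2 * D + 1) := by nlinarith
  have hP := fun net : Network n k => isPointing_points (F := F net) (lead := lead net) (D := D)
    (net.key_injective.injOn (s := net.graph.edgeSet))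
  let c : Network n k → Fin n → ℕ := fun net =>
    cvColor (lead net) (Points net.graph net.key (F net) (lead net) D)
      (fun u => net.ident (lead net u)) (logStar n)
  have hc : ∀ net u v, lead net u = lead net v → c net u = c net v := fun net =>
    cvColor_congr (fun u v h => congrArg net.ident h) _
  have hcq : ∀ net v, c net v < q := fun net v =>
    (cvColor_lt hB.two_le (fun u => net.ident_lt (lead net u)) _ v).trans_le
      ((paletteSize_logStar_le hn).trans_eq hq.symm)
  have hproper : ∀ net x y, Points net.graph net.key (F net) (lead net) D x y →
      c net x ≠ c net y := fun net =>
    cvColor_ne (hP net) (fun x y h => (net.ident_injective.ne ((hP net).ne x y h))) _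
  have hc4 : ∀ net v, c net v < (n ^ k) ^ 4 := fun net v => by
    have h2 := hB.two_le
    have h3 := hB.pow_four
    have h4 := cvColor_lt (lead := lead net) (P := Points net.graph net.key (F net) (lead net) D)
      h2 (fun u => net.ident_lt (lead net u)) (logStar n) v
    have h5 := paletteSize_le (p := n ^ k) (b := (n ^ k) * 8) (by omega) (by omega) (logStar n)
    exact h4.trans_le (by omega)
  have ht' : 2 * R ≤ t := by omega
  have h1 := (hf.learnTargetKey hB hI ht' (D := D) (by omega)).learnCvColor hB hI ht' (logStar n)
  have h2 := (h1.learnNextInf hB hI ht' hc4).learnPrevInf hB hI ht' hc4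
  have h3 := (h2.map fun x => (x.1, x.2.1, x.2.2.2.1 < x.2.2.1 ∧ x.2.2.2.2 < x.2.2.1)).learnMerge
    (c := c) hB hI hSD hc hcq hproper ht
  refine ⟨_, _, fun net => (hI net).merge (net.key_injective.injOn) hSD (hc net) (hcq net)
    (hproper net), h3.mono ?_⟩
  -- The target keys take `1 + 3 * t` rounds, the colors `logStar n * (1 + t)`, the two comparisons
  -- that determine peaks `2 * (1 + t)`, and the merge `1 + t`.
  nlinarith

end Phase

/-! ### The rooted trees of the clusters -/

section Tree

variable {V : Type} {G F : SimpleGraph V} {key : Sym2 V → ℕ} {lead : V → V} {R S : ℕ} {ident : V → ℕ}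

/-- The hop-distance to the root. -/
noncomputable def rootDist (F : SimpleGraph V) (lead : V → V) (v : V) : ℕ :=
  sInf {j | ∃ p : F.Walk v (lead v), p.length ≤ j}

/-- The smallest identifier of a neighbor that is closer to the root. -/
noncomputable def parentIdent (F : SimpleGraph V) (lead : V → V) (ident : V → ℕ) (v : V) : ℕ∞ :=
  ⨅ u, ⨅ (_ : F.Adj v u ∧ rootDist F lead u < rootDist F lead v), (ident u : ℕ∞)

open Classical in
/-- The parents in trees of shortest paths to the roots. -/
noncomputable def treeParent (F : SimpleGraph V) (lead : V → V) (ident : V → ℕ) (v : V) : V :=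
  if h : ∃ u, (F.Adj v u ∧ rootDist F lead u < rootDist F lead v) ∧
    (ident u : ℕ∞) = parentIdent F lead ident v then h.choose else v

theorem rootDist_le {v : V} {j : ℕ} (p : F.Walk v (lead v)) (hp : p.length ≤ j) :
    rootDist F lead v ≤ j := Nat.sInf_le ⟨p, hp⟩

theorem treeParent_of_eq_top {v : V} (h : parentIdent F lead ident v = ⊤) :
    treeParent F lead ident v = v := by
  rw [treeParent, dif_neg]
  rintro ⟨u, -, hu⟩
  exact ENat.natCast_ne_top _ (hu.trans h)

theorem treeParent_spec {v : V} (h : parentIdent F lead ident v ≠ ⊤) :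
    (F.Adj v (treeParent F lead ident v) ∧
      rootDist F lead (treeParent F lead ident v) < rootDist F lead v) ∧
      (ident (treeParent F lead ident v) : ℕ∞) = parentIdent F lead ident v := by
  have h' : ∃ u, (F.Adj v u ∧ rootDist F lead u < rootDist F lead v) ∧
    (ident u : ℕ∞) = parentIdent F lead ident v := exists_eq_of_iInf_ne_top h
  rw [treeParent, dif_pos h']
  exact h'.choose_spec

theorem ident_treeParent (v : V) [Decidable (parentIdent F lead ident v = ⊤)] :
    ident (treeParent F lead ident v) = if parentIdent F lead ident v = ⊤ then ident v else
      (parentIdent F lead ident v).toNat := by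
  split_ifs with h
  · rw [treeParent_of_eq_top h]
  · rw [← (treeParent_spec h).2, ENat.toNat_natCast]

namespace IsFragments

theorem exists_walk_le_rootDist (h : IsFragments G key F lead R S) (v : V) :
    ∃ p : F.Walk v (lead v), p.length ≤ rootDist F lead v := by
  obtain ⟨p, -⟩ := h.walk v
  exact Nat.sInf_mem (s := {j | ∃ p : F.Walk v (lead v), p.length ≤ j}) ⟨p.length, p, le_rfl⟩

theorem rootDist_le (h : IsFragments G key F lead R S) (v : V) : rootDist F lead v ≤ R := by
  obtain ⟨p, hp, -⟩ := h.walk v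
  exact _root_.rootDist_le p hp

theorem rootDist_lt_card [Finite V] (h : IsFragments G key F lead R S) (v : V) :
    rootDist F lead v < Nat.card V := by
  obtain ⟨p, -⟩ := h.walk v
  obtain ⟨q, hq, -⟩ := exists_walk_length_lt p
  exact (_root_.rootDist_le q le_rfl).trans_lt hq

theorem lead_eq_of_rootDist_eq_zero (h : IsFragments G key F lead R S) {v : V}
    (hv : rootDist F lead v = 0) : lead v = v := by
  obtain ⟨p, hp⟩ := h.exists_walk_le_rootDist v
  exact (Walk.eq_of_length_eq_zero (by omega : p.length = 0)).symm

theorem lead_treeParent (h : IsFragments G key F lead R S) (v : V) :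
    lead (treeParent F lead ident v) = lead v := by
  by_cases hv : parentIdent F lead ident v = ⊤
  · rw [treeParent_of_eq_top hv]
  · exact (h.lead_eq _ _ (treeParent_spec hv).1.1).symm

/-- The first step of a shortest walk to the root leads to a neighbor that is closer to the root. -/
theorem parentIdent_ne_top (h : IsFragments G key F lead R S) {v : V}
    (hv : rootDist F lead v ≠ 0) : parentIdent F lead ident v ≠ ⊤ := by
  obtain ⟨p, hp⟩ := h.exists_walk_le_rootDist v
  have key : ∀ w (q : F.Walk v w), w = lead v → q.length ≤ rootDist F lead v →
      parentIdent F lead ident v ≠ ⊤ := by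
    intro w q hw hq
    cases q with
    | nil =>
      refine absurd (_root_.rootDist_le (F := F) (lead := lead) (v := v) (j := 0)
        (Walk.nil.copy rfl hw) (by simp)) (by omega)
    | @cons _ u _ e q =>
      refine ne_top_of_le_ne_top (ENat.natCast_ne_top (ident u)) (iInf₂_le u ⟨e, ?_⟩)
      have := _root_.rootDist_le (q.copy rfl (hw.trans (h.lead_eq _ _ e))) le_rfl
      simp only [Walk.length_cons, Walk.length_copy] at hq this
      omega
  exact key _ p rfl hp

theorem iterate_treeParent (h : IsFragments G key F lead R S) {j : ℕ} {v : V}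
    (hj : rootDist F lead v ≤ j) : (treeParent F lead ident)^[j] v = lead v := by
  induction j generalizing v with
  | zero => exact (h.lead_eq_of_rootDist_eq_zero (v := v) (by omega)).symm
  | succ j ih =>
    rw [Function.iterate_succ_apply, ← h.lead_treeParent (ident := ident) v]
    refine ih ?_
    by_cases hv : rootDist F lead v = 0
    · rw [treeParent_of_eq_top]
      · omega
      · by_contra hne
        have := (treeParent_spec hne).1.2
        omega
    · have := (treeParent_spec (h.parentIdent_ne_top (ident := ident) hv)).1.2
      omega

theorem treeParent_lead (h : IsFragments G key F lead R S) (v : V) :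
    treeParent F lead ident (lead v) = lead v := by
  refine treeParent_of_eq_top ?_
  by_contra hne
  have h1 := (treeParent_spec hne).1.2
  have h2 : rootDist F lead (lead v) ≤ 0 :=
    _root_.rootDist_le (Walk.nil.copy rfl (h.lead_lead v).symm) (by simp)
  omega

/-- The clustering into the trees of those clusters that are not connected components. -/
noncomputable def toClustering (h : IsFragments G key F lead R S) (ident : V → ℕ) {r : ℕ}
    (hr : R ≤ r) : Clustering G r where
  -- Whole components are left out: they may have fewer than `S` nodes, and no edge leaves them.
  nodes := {v | clusterInf lead (outKey G key lead) v ≠ ⊤}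
  parent := treeParent F lead ident
  parent_mem v hv := by
    rw [Set.mem_ofPred_eq, clusterInf_congr lead _ (h.lead_treeParent v)]
    exact hv
  parent_adj v _ hne := by
    by_cases hv : parentIdent F lead ident v = ⊤
    · exact absurd (treeParent_of_eq_top hv) hne
    · exact h.le (treeParent_spec hv).1.1
  radius_le v _ := by
    rw [h.iterate_treeParent ((h.rootDist_le v).trans hr), h.treeParent_lead]

variable (h : IsFragments G key F lead R S) {r : ℕ} (hr : R ≤ r)

theorem toClustering_root (v : V) : (h.toClustering ident hr).root v = lead v :=
  h.iterate_treeParent ((h.rootDist_le v).trans hr)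

theorem mem_nodes_of_adj {u v : V} (huv : G.Adj u v) (hne : lead u ≠ lead v) :
    u ∈ (h.toClustering ident hr).nodes :=
  ne_top_of_le_ne_top (ENat.natCast_ne_top _)
    ((clusterInf_le lead _ rfl).trans (outKey_le huv hne.symm))

theorem lead_mem_nodes {v : V} (hv : v ∈ (h.toClustering ident hr).nodes) :
    lead v ∈ (h.toClustering ident hr).nodes ∧
      (h.toClustering ident hr).parent (lead v) = lead v := by
  refine ⟨?_, h.treeParent_lead v⟩
  change clusterInf lead _ (lead v) ≠ ⊤
  rw [clusterInf_congr lead _ (h.lead_lead v)]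
  exact hv

theorem lead_node (c : (h.toClustering ident hr).Node) : lead c.1 = c.1 := by
  rw [← h.toClustering_root (ident := ident) hr c.1]
  exact Function.iterate_fixed c.2.2 r

/-- Large clusters are few. -/
theorem card_node_mul_le [Finite V] :
    Nat.card (h.toClustering ident hr).Node * S ≤ Nat.card V := by
  classical
  have := Fintype.ofFinite V
  have hsize : ∀ c : (h.toClustering ident hr).Node,
      S ≤ (Finset.univ.filter fun u => lead u = c.1).card := by
    intro c
    have h1 := h.size c.1 c.2.1
    rw [h.lead_node hr c, Set.ncard_eq_toFinset_card'] at h1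
    simpa using h1
  have h2 : ∑ c : (h.toClustering ident hr).Node, (Finset.univ.filter fun u => lead u = c.1).card ≤
      Fintype.card V := by
    rw [← Finset.card_biUnion]
    · exact Finset.card_le_univ _
    · intro c _ d _ hcd
      rw [Function.onFun, Finset.disjoint_left]
      intro u hu hu'
      simp only [Finset.mem_filter, Finset.mem_univ, true_and] at hu hu'
      exact hcd (Subtype.ext (hu.symm.trans hu'))
  have h3 := Finset.card_nsmul_le_sum Finset.univ
    (fun c : (h.toClustering ident hr).Node => (Finset.univ.filter fun u => lead u = c.1).card) S
    fun c _ => hsize c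
  rw [Nat.card_eq_fintype_card, Nat.card_eq_fintype_card]
  simpa using h3.trans h2

end IsFragments

theorem IsFragments.mono (h : IsFragments G key F lead R S) {R' : ℕ} (hR : R ≤ R') :
    IsFragments G key F lead R' S where
  le := h.le
  lead_eq := h.lead_eq
  walk v := by
    obtain ⟨p, hp, he⟩ := h.walk v
    exact ⟨p, hp.trans hR, he⟩
  inner u v huv hl := by
    obtain ⟨p, hp, he⟩ := h.inner u v huv hl
    exact ⟨p, by omega, he⟩
  cut := h.cut
  size := h.size

end Tree

/-! ### The algorithm for a fixed number of processors. -/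

section

variable {n k B : ℕ}

/-- Clusters with at least `2 ^ i` nodes can be computed fast. -/
theorem exists_fragments (hB : MessagesFit n k B) (hn : 2 ≤ n) (i : ℕ) :
    ∃ (F : Network n k → SimpleGraph (Fin n)) (lead : Network n k → Fin n → Fin n),
      (∀ net, IsFragments net.graph net.key (F net) (lead net)
        (5 * (2 * 2 ^ (k + 4) + 1) * 2 ^ i) (2 ^ i)) ∧
      Known B ((logStar n + 6) * (21 * (2 * 2 ^ (k + 4) + 1) * 2 ^ i))
        (fun net v => net.clusterState (F net) (lead net) v) := by
  induction i with
  | zero =>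
    refine ⟨fun _ => ⊥, fun _ => id,
      fun net => (IsFragments.singletons net.graph net.key).mono (Nat.zero_le _), ?_⟩
    refine ((Known.view.map fun x => (x, x.ident, (∅ : Set ℕ))).congr fun net v => ?_).mono
      (Nat.zero_le _)
    simp [Network.clusterState, Network.treeNbrs, Network.view]
  | succ i ih =>
    obtain ⟨F, lead, hI, hf⟩ := ih
    have hpos : 1 ≤ 2 ^ i := Nat.one_le_two_pow
    generalize hM : 2 * 2 ^ (k + 4) + 1 = M at hI hf
    have hMpos : 1 ≤ M := by omega
    have hMi : M ≤ M * 2 ^ i := Nat.le_mul_of_pos_right _ hpos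
    -- The increment of the radius is at most `5 * M * 2 ^ i`, so the bound doubles together with
    -- the size.
    have hR : M * (2 * 2 ^ (i + 1) + 1) + 5 * M * 2 ^ i ≤ 5 * M * 2 ^ (i + 1) := by
      rw [pow_succ]; nlinarith
    obtain ⟨F', lead', hI', hf'⟩ := hf.exists_merge (D := 2 ^ (i + 1)) (q := 2 ^ (k + 4))
      (t := 10 * M * 2 ^ (i + 1)) hB hI hn (by rw [pow_succ]; omega) rfl
      (by rw [hM]; linarith)
    rw [hM] at hI'
    refine ⟨F', lead', fun net => ?_, hf'.mono ?_⟩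
    · have := (hI' net).mono hR
      rwa [mul_comm 2, ← pow_succ] at this
    -- Apart from the factor `logStar n + 6`, this phase costs `1 + 20 * M * 2 ^ i`, at most the `21
    -- * M * 2 ^ i` allotted to all earlier phases.
    · rw [← mul_add]
      refine Nat.mul_le_mul_left _ ?_
      rw [pow_succ]
      nlinarith

variable {τ : ℕ} {F : Network n k → SimpleGraph (Fin n)}
  {lead : Network n k → Fin n → Fin n} {R S : ℕ}

open Classical in
/-- The processors find out the input of an algorithm on the cluster graph. -/
theorem Known.learnClusterView (hB : MessagesFit n k B)
    (hI : ∀ net, IsFragments net.graph net.key (F net) (lead net) R S) {r : ℕ} (hr : R ≤ r) (N : ℕ)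
    (hf : Known B τ fun net v => net.clusterState (F net) (lead net) v) :
    Known B (τ + 4 * R + 2) (fun net v => (net.clusterState (F net) (lead net) v,
      net.clusterView ((hI net).toClustering net.ident hr) N v)) := by
  -- Both floodings take `2 * R` rounds. The remaining two rounds exchange root identifiers and
  -- distances to the root.
  have h1 := ((hf.learnClusterOutKey hB hI le_rfl).learnRootDist hB hI (t := R + R))
  have h2 := (h1.map fun x => (x.1, sInf {j | x.2 j})).congr (g := fun net v =>
    ((net.clusterState (F net) (lead net) v,
      clusterInf (lead net) (outKey net.graph net.key (lead net)) v),
      rootDist (F net) (lead net) v)) fun net v => by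
    refine Prod.ext rfl (le_antisymm (Nat.sInf_le ?_) ?_)
    · obtain ⟨p, hp⟩ := (hI net).exists_walk_le_rootDist v
      have := (hI net).rootDist_le v
      exact ⟨p, le_min hp (by omega)⟩
    · obtain ⟨p, hp, -⟩ := (hI net).walk v
      obtain ⟨q, hq⟩ := Nat.sInf_mem (s := {j | ∃ p : (F net).Walk v (lead net v),
        p.length ≤ min j (R + R)}) ⟨R, p, by omega⟩
      exact rootDist_le q (hq.trans (min_le_left _ _))
  have h3 := h2.nbrInf (fun x _ => x.2) (fun net u v _ => hB.size_le _ (by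
      have h4 := (hI net).rootDist_lt_card u
      have h5 := hB.le_pow
      have h6 := hB.pow_four
      rw [Nat.card_fin] at h4
      dsimp only
      omega)) fun x i a => if i ∈ x.1.1.2.2 ∧ a < x.2 then (i : ℕ∞) else ⊤
  have h4 := h3.congr (g := fun net v => (((net.clusterState (F net) (lead net) v,
      clusterInf (lead net) (outKey net.graph net.key (lead net)) v),
      rootDist (F net) (lead net) v), parentIdent (F net) (lead net) net.ident v)) fun net v => by
    refine Prod.ext rfl (iInf_congr fun u => ?_)
    have e1 : net.ident u ∈ (net.clusterState (F net) (lead net) v).2.2 ↔ (F net).Adj v u :=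
      net.ident_mem_treeNbrs
    dsimp only
    rw [e1]
    by_cases hu : net.graph.Adj v u
    · simp only [hu, iInf_true]
      rw [iInf_eq_if]
    · have : ¬ (F net).Adj v u := fun h => hu ((hI net).le h)
      simp [hu, this]
  refine ((h4.map fun x => (x.1.1.1, ({ x.1.1.1.1 with
      numClusters := N
      radius := r
      cluster := if x.1.1.2 ≠ ⊤ then
        some (x.1.1.1.2.1, if x.2 = ⊤ then x.1.1.1.1.ident else x.2.toNat) else none } :
      ClusterView))).congr fun net v => ?_).mono (by omega)
  refine Prod.ext rfl ?_
  dsimp only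
  rw [Network.clusterView, (hI net).toClustering_root hr v]
  have e1 : net.ident (((hI net).toClustering net.ident hr).parent v) =
    if parentIdent (F net) (lead net) net.ident v = ⊤ then net.ident v else
      (parentIdent (F net) (lead net) net.ident v).toNat := ident_treeParent v
  rw [e1]
  exact congrArg (ClusterView.mk (net.view v) N r) (if_congr Iff.rfl rfl rfl)

/-- The spanner algorithm for networks of a fixed size. -/
theorem exists_known_spanner {α s : ℕ → ℝ} {T : ℕ → ℕ → ℕ} {b : ℕ} {A : Algorithm ClusterView}
    (hA : A.SolvesClusterGraphs k b α s T) (hα : ∀ N, 1 ≤ α N) (hB : MessagesFit n k B)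
    (hbB : b * Nat.size n ≤ B) (hn : 2 ≤ n) (i : ℕ) {N r : ℕ}
    (hr : 5 * (2 * 2 ^ (k + 4) + 1) * 2 ^ i ≤ r) (hNn : N ≤ n)
    (hN : ∀ x, x ≤ n → x * 2 ^ i ≤ n → x ≤ N) :
    ∃ E : Network n k → Fin n → Set ℕ,
      Known B ((logStar n + 8) * (21 * (2 * 2 ^ (k + 4) + 1) * 2 ^ i) + T N r) E ∧
      ∀ net, ∃ H : SimpleGraph (Fin n),
        (∀ u v, net.graph.Adj u v → (net.ident v ∈ E net u ↔ H.Adj u v)) ∧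
        net.toWeightedGraph.IsSpanner H
          ((4 * (5 * (2 * 2 ^ (k + 4) + 1) * 2 ^ i : ℕ) + 1) * α N) ∧
        (H.edgeSet.ncard : ℝ) ≤ n + N * s N := by
  obtain ⟨F, lead, hI, hf⟩ := exists_fragments hB hn i
  generalize hM : 2 * 2 ^ (k + 4) + 1 = M at hI hf hr ⊢
  have hcard : ∀ net, Nat.card ((hI net).toClustering net.ident hr).Node ≤ N := by
    intro net
    refine hN _ ?_ ?_
    · exact (Nat.card_le_card_of_injective _ Subtype.val_injective).trans_eq (Nat.card_fin n)
    · exact ((hI net).card_node_mul_le hr).trans_eq (Nat.card_fin n)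
  choose H hH hspan hedge using fun net => hA n N r hNn net _ (hcard net)
  have h1 := (hf.learnClusterView hB hI hr N).run A Prod.snd (T N r)
    fun net j hj u v huv => ((hH net).1 j hj u v huv).trans hbB
  refine ⟨_, (h1.map fun x => {i | i ∈ x.1.1.2.2 ∨ i ∈ A.output x.2}).mono ?_, fun net =>
    ⟨F net ⊔ H net, ?_, ?_, ?_⟩⟩
  -- With `R = 5 * M * 2 ^ i`, the `4 * R + 2` rounds for the cluster view fit into two further
  -- units of `21 * M * 2 ^ i`.
  · have : 1 ≤ M * 2 ^ i := Nat.mul_pos (by omega) (Nat.two_pow_pos i)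
    nlinarith
  · intro u v huv
    rw [sup_adj, ← (hH net).2 u v huv, ← net.ident_mem_treeNbrs]
    rfl
  · exact isSpanner_sup (hI net) (fun e f _ _ => net.weight_le_of_key_le e f)
      (fun v _ => (hI net).toClustering_root hr v) (fun v hv => (hI net).lead_mem_nodes hr hv)
      (fun u v huv hne => (hI net).mem_nodes_of_adj hr huv hne) (hα N) (hspan net)
  · have h2 := ((hI net).isAcyclic (net.key_injective.injOn)).ncard_edgeSet_le
    rw [Nat.card_fin] at h2
    have h3 : (F net ⊔ H net).edgeSet.ncard ≤ n + (H net).edgeSet.ncard := by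
      rw [edgeSet_sup]
      exact (Set.ncard_union_le _ _).trans (by omega)
    calc ((F net ⊔ H net).edgeSet.ncard : ℝ) ≤ n + (H net).edgeSet.ncard := by exact_mod_cast h3
      _ ≤ n + N * s N := by linarith [hedge net]

end

/-! ### Lower bounds on `s` and the choice of the parameters. -/

section

variable {k b : ℕ} {α s : ℕ → ℝ} {T : ℕ → ℕ → ℕ} {A : Algorithm ClusterView}

/-- The clustering into single nodes. -/
def singletonClustering {V : Type} (G : SimpleGraph V) : Clustering G 0 where
  nodes := Set.univ
  parent := id
  parent_mem := fun _ _ => trivial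
  parent_adj := fun _ _ h => absurd rfl h
  radius_le := fun _ _ => rfl

/-- The complete network with `n` processors and weights `0`. -/
def completeNetwork {n k : ℕ} (h : n ≤ n ^ k) : Network n k where
  graph := ⊤
  weight := fun _ => 0
  ident := fun v => v
  ident_injective := Fin.val_injective
  ident_lt := fun v => v.2.trans_le h
  weight_le := fun _ _ => Nat.zero_le _

theorem card_node_singletonClustering_le {n : ℕ} (G : SimpleGraph (Fin n)) :
    Nat.card (singletonClustering G).Node ≤ n :=
  (Nat.card_le_card_of_injective _ Subtype.val_injective).trans_eq (Nat.card_fin n)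

theorem zero_le_of_solvesClusterGraphs (hA : A.SolvesClusterGraphs k b α s T) : 0 ≤ s 1 := by
  let net : Network 1 k := completeNetwork (by simp)
  obtain ⟨F, -, -, h⟩ := hA 1 1 0 le_rfl net (singletonClustering _)
    (card_node_singletonClustering_le _)
  have h1 : (0 : ℝ) ≤ F.edgeSet.ncard := Nat.cast_nonneg _
  simp only [Nat.cast_one, one_mul] at h
  exact h1.trans h

/-- Two clusters that are joined by an edge require an edge of the spanner. -/
theorem half_le_of_solvesClusterGraphs (hA : A.SolvesClusterGraphs k b α s T) (hk : k ≠ 0) :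
    1 / 2 ≤ s 2 := by
  let net : Network 2 k := completeNetwork (Nat.le_self_pow hk 2)
  obtain ⟨F, -, hspan, h⟩ := hA 2 2 0 le_rfl net (singletonClustering _)
    (card_node_singletonClustering_le _)
  let K := singletonClustering net.graph
  let c : K.Node := ⟨0, trivial, rfl⟩
  let d : K.Node := ⟨1, trivial, rfl⟩
  have hcd : c ≠ d := fun h => zero_ne_one (congrArg Subtype.val h : (0 : Fin 2) = 1)
  have hadj : (K.contract net.toWeightedGraph).graph.Adj c d :=
    ⟨hcd, 0, trivial, 1, trivial, by simp [net, completeNetwork], rfl, rfl⟩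
  have h1 : (K.contract (net.toWeightedGraph.restrict F)).dist c d < ⊤ := by
    refine (hspan.2.2 c d).trans_lt (ENNReal.mul_lt_top ENNReal.ofReal_lt_top ?_)
    exact (WeightedGraph.dist_le_of_adj hadj).trans_lt (ENNReal.natCast_lt_top _)
  have h2 : Nonempty ((K.contract (net.toWeightedGraph.restrict F)).graph.Walk c d) := by
    by_contra hcon
    rw [not_nonempty_iff] at hcon
    rw [WeightedGraph.dist, iInf_of_empty] at h1
    exact lt_irrefl _ h1
  have h3 : F.edgeSet.Nonempty := by
    obtain ⟨p⟩ := h2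
    obtain ⟨-, u, -, v, -, huv, -⟩ := p.adj_snd (Walk.not_nil_of_ne hcd)
    exact ⟨s(u, v), huv⟩
  have h4 : (1 : ℝ) ≤ F.edgeSet.ncard := by
    exact_mod_cast (Set.ncard_pos (Set.toFinite _)).2 h3
  have h5 : (1 : ℝ) ≤ 2 * s 2 := h4.trans (by exact_mod_cast h)
  linarith

/-- In networks with at most one processor, there is nothing to do. -/
theorem isSpanner_bot_of_le_one {n : ℕ} (hn : n ≤ 1) (W : WeightedGraph (Fin n)) (β : ℝ) :
    W.IsSpanner ⊥ β := by
  have : Subsingleton (Fin n) := Fin.subsingleton_iff_le_one.2 hn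
  refine ⟨bot_le, fun u v => ?_⟩
  rw [Subsingleton.elim u v, WeightedGraph.dist_self]
  exact zero_le

/-- The spanner algorithm for networks of a fixed size, with its bounds. -/
theorem exists_known_spanner_of_size (hA : A.SolvesClusterGraphs k b α s T)
    (hα : ∀ N, 1 ≤ α N) (hαmono : Monotone α) (hs : Monotone s)
    (hT : ∀ r, Monotone fun N => T N r) {t : ℝ} (ht : 1 ≤ t) (n : ℕ) :
    ∃ (E : Network n k → Fin n → Set ℕ) (ρ : ℕ),
      Known ((b + 4 * k) * Nat.size n) ρ E ∧
      (ρ : ℝ) ≤ (1134 * (2 * 2 ^ (k + 4) + 1 : ℕ)) * (t * s n * logStar n +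
        T ⌊(n : ℝ) / (t * s n)⌋₊ ⌊(1134 * (2 * 2 ^ (k + 4) + 1 : ℕ)) * (t * s n)⌋₊) ∧
      ∀ net, ∃ H : SimpleGraph (Fin n),
        (∀ u v, net.graph.Adj u v → (net.ident v ∈ E net u ↔ H.Adj u v)) ∧
        net.toWeightedGraph.IsSpanner H
          ((1134 * (2 * 2 ^ (k + 4) + 1 : ℕ)) * (t * s n * α n)) ∧
        (H.edgeSet.ncard : ℝ) ≤ n + n / t := by
  have htriv : Known ((b + 4 * k) * Nat.size n) 0
      (fun (_ : Network n k) (_ : Fin n) => (∅ : Set ℕ)) := Known.view.map fun _ => ∅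
  rcases Nat.lt_or_ge 1 n with hn | hn
  swap
  · refine ⟨_, 0, htriv, ?_, fun net => ⟨⊥, ?_, isSpanner_bot_of_le_one hn _ _, ?_⟩⟩
    -- Here `s n` may be negative, but it is multiplied by `log* n = 0`.
    · rw [logStar_of_le_one hn]
      simp only [Nat.cast_zero, mul_zero, zero_add]
      positivity
    · simp
    · simp only [edgeSet_bot, Set.ncard_empty, Nat.cast_zero]
      positivity
  by_cases hk : k = 0
  -- For `k = 0` all identifiers would be `0`, which is impossible with two processors.
  · have : IsEmpty (Network n k) := ⟨fun net => by
      have h1 := net.ident_lt ⟨0, by omega⟩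
      have h2 := net.ident_lt ⟨1, by omega⟩
      have h3 : n ^ k = 1 := by rw [hk, pow_zero]
      have h4 := net.ident_injective ((Nat.lt_one_iff.1 (h1.trans_eq h3)).trans
        (Nat.lt_one_iff.1 (h2.trans_eq h3)).symm)
      simp at h4⟩
    refine ⟨_, 0, htriv, ?_, fun net => isEmptyElim net⟩
    have h1 : 0 ≤ s n := (zero_le_of_solvesClusterGraphs hA).trans (hs (by omega))
    have h2 : 0 ≤ t := by linarith
    rw [Nat.cast_zero]
    positivity
  have hsn : 1 / 2 ≤ s n := (half_le_of_solvesClusterGraphs hA hk).trans (hs hn)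
  set M : ℕ := 2 * 2 ^ (k + 4) + 1 with hM
  have hM1 : (1 : ℝ) ≤ M := by exact_mod_cast (by omega : 1 ≤ M)
  set X : ℝ := t * s n with hX
  have hX2 : 1 / 2 ≤ X := by nlinarith
  have hXpos : 0 < X := by linarith
  -- The least `i` with `X ≤ 2 ^ i`: clusters become large enough, while their radius is still
  -- `O(X)`.
  set i : ℕ := Nat.clog 2 ⌈X⌉₊ with hi
  have hceil : (⌈X⌉₊ : ℝ) < X + 1 := Nat.ceil_lt_add_one hXpos.le
  have hXi : X ≤ (2 ^ i : ℕ) :=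
    (Nat.le_ceil X).trans (by exact_mod_cast Nat.le_pow_clog (by norm_num) _)
  -- Rounding up to a power of two at most doubles `⌈X⌉₊ < X + 1`, and `X + 1 ≤ 3 * X` since `1 / 2
  -- ≤ X`. If `⌈X⌉₊ ≤ 1`, the power is `1`.
  have hiX : ((2 ^ i : ℕ) : ℝ) ≤ 6 * X := by
    rcases Nat.lt_or_ge 1 ⌈X⌉₊ with h1 | h1
    · have h2 := Nat.pow_pred_clog_lt_self (b := 2) (by norm_num) h1
      have h3 := Nat.clog_pos (b := 2) (by norm_num) h1
      have h4 : 2 ^ i ≤ 2 * ⌈X⌉₊ := by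
        obtain ⟨j, hj⟩ : ∃ j, Nat.clog 2 ⌈X⌉₊ = j + 1 := ⟨_, (Nat.succ_pred_eq_of_pos h3).symm⟩
        rw [hj, Nat.pred_succ] at h2
        rw [hi, hj, pow_succ]
        omega
      have h5 : ((2 ^ i : ℕ) : ℝ) ≤ 2 * ⌈X⌉₊ := by exact_mod_cast h4
      linarith
    · rw [hi, Nat.clog_of_right_le_one h1]
      norm_num
      linarith
  -- For `X < 1` the quotient can exceed `n`, but `A` requires `N ≤ n`.
  set N : ℕ := min n ⌊(n : ℝ) / X⌋₊ with hN
  have hR : 5 * M * 2 ^ i ≤ ⌊(1134 * (M : ℝ)) * X⌋₊ := by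
    refine Nat.le_floor ?_
    have h1 : ((5 * M * 2 ^ i : ℕ) : ℝ) = 5 * M * (2 ^ i : ℕ) := by push_cast; ring
    rw [h1]
    have h2 : 5 * (M : ℝ) * (2 ^ i : ℕ) ≤ 5 * M * (6 * X) :=
      mul_le_mul_of_nonneg_left hiX (by positivity)
    have h3 : 0 ≤ (M : ℝ) * X := by positivity
    linarith
  have hbig : b * Nat.size n ≤ (b + 4 * k) * Nat.size n := Nat.mul_le_mul_right _ (by omega)
  obtain ⟨E, hE, hspec⟩ := exists_known_spanner hA hα
    (messagesFit hn hk (Nat.mul_le_mul_right (Nat.size n) (by omega : 4 * k ≤ b + 4 * k)))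
    hbig hn i (N := N) hR (min_le_left _ _) (by
      intro x hx hxi
      refine le_min hx (Nat.le_floor ?_)
      rw [le_div_iff₀ hXpos]
      calc (x : ℝ) * X ≤ x * (2 ^ i : ℕ) := mul_le_mul_of_nonneg_left hXi (Nat.cast_nonneg x)
        _ ≤ n := by exact_mod_cast hxi)
  refine ⟨E, _, hE, ?_, fun net => ?_⟩
  · rw [← hM]
    have hL : (1 : ℝ) ≤ logStar n := by exact_mod_cast one_le_logStar hn
    have h1 : (T N ⌊(1134 * (M : ℝ)) * X⌋₊ : ℝ) ≤
        T ⌊(n : ℝ) / X⌋₊ ⌊(1134 * (M : ℝ)) * X⌋₊ := by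
      exact_mod_cast hT _ (min_le_right _ _)
    have h2 : (0 : ℝ) ≤ T ⌊(n : ℝ) / X⌋₊ ⌊(1134 * (M : ℝ)) * X⌋₊ := Nat.cast_nonneg _
    push_cast at hiX ⊢
    -- The constant is `1134 = 9 * 21 * 6`: `log* n + 8 ≤ 9 * log* n`, and `2 ^ i ≤ 6 * X`.
    have h3 : ((logStar n : ℝ) + 8) * (21 * M * 2 ^ i) ≤ (9 * logStar n) * (21 * M * (6 * X)) := by
      refine mul_le_mul (by linarith) (mul_le_mul_of_nonneg_left hiX (by positivity))
        (by positivity) (by positivity)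
    have h4 : (T ⌊(n : ℝ) / X⌋₊ ⌊(1134 * (M : ℝ)) * X⌋₊ : ℝ) ≤
        (1134 * M) * T ⌊(n : ℝ) / X⌋₊ ⌊(1134 * (M : ℝ)) * X⌋₊ :=
      le_mul_of_one_le_left h2 (by linarith)
    linarith
  · obtain ⟨H, h1, h2, h3⟩ := hspec net
    refine ⟨H, h1, ⟨h2.1, fun u v => (h2.2 u v).trans (mul_le_mul_left ?_ _)⟩, ?_⟩
    · refine ENNReal.ofReal_le_ofReal ?_
      rw [← hM]
      have h4 : α N ≤ α n := hαmono (min_le_left _ _)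
      have h5 : 0 ≤ α N := zero_le_one.trans (hα N)
      have h6 : (4 * ((5 * M * 2 ^ i : ℕ) : ℝ) + 1) ≤ 1134 * M * X := by
        push_cast at hiX ⊢
        have h7 : (M : ℝ) * 2 ^ i ≤ M * (6 * X) := mul_le_mul_of_nonneg_left hiX (by positivity)
        nlinarith
      calc (4 * ((5 * M * 2 ^ i : ℕ) : ℝ) + 1) * α N ≤ (1134 * M * X) * α n :=
            mul_le_mul h6 h4 h5 (by positivity)
        _ = _ := by ring
    · refine h3.trans (add_le_add le_rfl ?_)
      have h4 : (N : ℝ) ≤ n / X :=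
        (Nat.cast_le.2 (min_le_right _ _)).trans (Nat.floor_le (by positivity))
      have h5 : s N ≤ s n := hs (min_le_left _ _)
      have hspos : 0 < s n := by linarith
      calc (N : ℝ) * s N ≤ N * s n := mul_le_mul_of_nonneg_left h5 (Nat.cast_nonneg N)
        _ ≤ n / X * s n := mul_le_mul_of_nonneg_right h4 hspos.le
        _ = n / t := by rw [hX]; field_simp

end

theorem mainTheorem2 (k : ℕ) :
    ∃ C : ℝ, 0 < C ∧ ∀ b : ℕ, ∃ b' : ℕ,
      ∀ (α s : ℕ → ℝ) (T : ℕ → ℕ → ℕ),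
        (∀ N, 1 ≤ α N) → Monotone α → Monotone s → (∀ r, Monotone fun N => T N r) →
        (∃ A : Algorithm ClusterView, A.SolvesClusterGraphs k b α s T) →
        ∀ t : ℝ, 1 ≤ t →
          ∃ (A' : Algorithm LocalView) (ρ : ℕ → ℕ), ∀ n : ℕ,
            (ρ n : ℝ) ≤ C * (t * s n * logStar n +
              T ⌊(n : ℝ) / (t * s n)⌋₊ ⌊C * (t * s n)⌋₊) ∧
            ∀ net : Network n k, ∃ F : SimpleGraph (Fin n),
              net.Computes A' net.view b' (ρ n) F ∧
              net.toWeightedGraph.IsSpanner F (C * (t * s n * α n)) ∧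
              (F.edgeSet.ncard : ℝ) ≤ n + n / t := by
  refine ⟨1134 * (2 * 2 ^ (k + 4) + 1 : ℕ), by positivity, fun b => ⟨b + 4 * k, ?_⟩⟩
  rintro α s T hα hαmono hs hT ⟨A, hA⟩ t ht
  choose E ρ hE hρ hspec using exists_known_spanner_of_size hA hα hαmono hs hT ht
  obtain ⟨A', hA'⟩ := exists_algorithm_of_known ρ E hE
  refine ⟨A', ρ, fun n => ⟨hρ n, fun net => ?_⟩⟩
  obtain ⟨H, h1, h2, h3⟩ := hspec n net
  exact ⟨H, hA' n net H h1, h2, h3⟩
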